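/- Let $f:\mathbb R^n\to\mathbb R$ be convex and $c_1,\dots,c_m:\mathbb R^n\to\mathbb R$ be concave, all of class $C^2$, and let $\Omega=\{x\in\mathbb R^n: c_i(x)\ge 0,\ i=1,\dots,m\}$. Assume Slater's condition ($c_i(x_0)>0$ for all $i$, for some $x_0$), and let $x^*$ be a minimizer of $f$ on $\Omega$, the set of all minimizers being bounded. Fix a "center" $y\in\operatorname{int}\Omega$ with $f(y)>f(x^*)$. Put $F(x,y)=-\ln(f(y)-f(x))$ and $L_y(x,\lambda)=F(x,y)-\sum_{i=1}^m\lambda_ic_i(x)$, and define the exterior distance function (EDF) $$\mathcal L_y(x,\lambda,k)=F(x,y)-k^{-1}\sum_{i=1}^m\lambda_i\ln(kc_i(x)+1)$$ on its domain $D_k=\{x: f(x)<f(y),\ kc_i(x)+1>0,\ i=1,\dots,m\}$. Let $\|a\|=\max_i|a_i|$. Let $I=\{i: c_i(x^*)=0\}$, and let $\lambda^*\in\mathbb R^m_+$ be such that $(x^*,\lambda^*)$ is a KKT pair: $\nabla_xL_y(x^*,\lambda^*)=0$ and $\lambda^*_ic_i(x^*)=0$ for all $i$. Assume the second-order sufficient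 optimality condition: there is $\mu>0$ with $(\nabla^2_{xx}L_y(x^*,\lambda^*)u,u)\ge\mu(u,u)$ for all $u$ such that $(\nabla c_i(x^*),u)=0$ for all $i\in I$; the matrix with rows $\nabla c_i(x^*)$, $i\in I$, has rank $|I|$; and $\lambda_i^*>0$ for $i\in I$. For $k,\delta>0$ let $\Lambda(k,\delta)$ be the set of all $\lambda\in\mathbb R^m$ with $\lambda_i\ge\delta$ and $|\lambda_i-\lambda_i^*|\le\delta k$ for $i\in I$, and $0\le\lambda_i\le\delta k$ for $i\notin I$. Then there is $c>0$ such that for every $\alpha>0$ there are $\delta_0>0$ and $k_0>0$ such that for all $0<\delta\le\delta_0$, all $k\ge k_0$ and all $\lambda\in\Lambda(k,\delta)$ the following holds. 1. There is a pair $(\bar x,\bar\lambda)$ with $\bar x\in D_k$, $$\|\nabla_x\mathcal L_y(\bar x,\lambda,k)\|\le\frac{\alpha}{k}\|\bar\lambda-\lambda\|,\qquad \bar\lambda_i=\frac{\lambda_i}{kc_i(\bar x)+1},\quad i=1,\dots,m.\qquad(*)$$ 2. Every pair $(\bar x,\bar\lambda)$ with $\bar x\in D_k$ and $(*)$ satisfies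 $$\max\{\|\bar x-x^*\|,\|\bar\lambda-\lambda^*\|\}\le\frac{c}{k}(1+2\alpha)\|\lambda-\lambda^*\|.$$ 3. For every such pair the function $x\mapsto\mathcal L_y(x,\lambda,k)$ is strongly convex in a neighborhood of $\bar x$ contained in $D_k$. -/

import Mathlib

namespace ExteriorDistance

open Set

noncomputable section

/-- The max-norm `max_j |a_j|` of a vector of `ℝⁿ` (the norm of `Fin n → ℝ` is the sup norm).
For vectors of multipliers, which live in `Fin m → ℝ`, the built-in norm is this one. -/
def maxNorm {n : ℕ} (a : EuclideanSpace ℝ (Fin n)) : ℝ := ‖WithLp.ofLp a‖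

/-- The feasible set `Ω = {x : c_i(x) ≥ 0, i = 1, …, m}`. -/
def feasibleSet {n m : ℕ} (c : Fin m → EuclideanSpace ℝ (Fin n) → ℝ) :
    Set (EuclideanSpace ℝ (Fin n)) :=
  {x | ∀ i, 0 ≤ c i x}

/-- `F(x, y) = -ln (f(y) - f(x))`; meaningful where `f x < f y`. -/
def logObjective {n : ℕ} (f : EuclideanSpace ℝ (Fin n) → ℝ)
    (y x : EuclideanSpace ℝ (Fin n)) : ℝ :=
  -Real.log (f y - f x)

/-- The classical Lagrangian `L_y(x, l) = F(x, y) - ∑ l_i c_i(x)`. -/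
def lagrangian {n m : ℕ} (f : EuclideanSpace ℝ (Fin n) → ℝ)
    (c : Fin m → EuclideanSpace ℝ (Fin n) → ℝ) (y : EuclideanSpace ℝ (Fin n))
    (l : Fin m → ℝ) (x : EuclideanSpace ℝ (Fin n)) : ℝ :=
  logObjective f y x - ∑ i, l i * c i x

/-- The exterior distance function
`𝓛_y(x, l, k) = F(x, y) - k⁻¹ ∑ l_i ln (k c_i(x) + 1)`; meaningful on `edfDomain`. -/
def edf {n m : ℕ} (f : EuclideanSpace ℝ (Fin n) → ℝ)
    (c : Fin m → EuclideanSpace ℝ (Fin n) → ℝ) (y : EuclideanSpace ℝ (Fin n))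
    (l : Fin m → ℝ) (k : ℝ) (x : EuclideanSpace ℝ (Fin n)) : ℝ :=
  logObjective f y x - k⁻¹ * ∑ i, l i * Real.log (k * c i x + 1)

/-- The set on which all the logarithms in the exterior distance function have a positive
argument. -/
def edfDomain {n m : ℕ} (f : EuclideanSpace ℝ (Fin n) → ℝ)
    (c : Fin m → EuclideanSpace ℝ (Fin n) → ℝ) (y : EuclideanSpace ℝ (Fin n)) (k : ℝ) :
    Set (EuclideanSpace ℝ (Fin n)) :=
  {x | f x < f y ∧ ∀ i, 0 < k * c i x + 1}

/-- The updated multipliers `l_i ψ'(k c_i(x)) = l_i (k c_i(x) + 1)⁻¹`, `ψ(t) = ln (t + 1)`. -/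
def updatedMultipliers {n m : ℕ} (c : Fin m → EuclideanSpace ℝ (Fin n) → ℝ)
    (l : Fin m → ℝ) (k : ℝ) (x : EuclideanSpace ℝ (Fin n)) : Fin m → ℝ :=
  fun i => l i * (k * c i x + 1)⁻¹

/-- The Jacobian `∇c_(r)(x)` of the constraints that are active at `x`. -/
def activeJacobian {n m : ℕ} (c : Fin m → EuclideanSpace ℝ (Fin n) → ℝ)
    (x : EuclideanSpace ℝ (Fin n)) :
    EuclideanSpace ℝ (Fin n) →L[ℝ] ({i : Fin m // c i x = 0} → ℝ) :=
  ContinuousLinearMap.pi fun i => fderiv ℝ (c i) x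

/-- `(xs, ls)` is a Karush-Kuhn-Tucker pair of the problem
`min {F(x, y) : c_i(x) ≥ 0, i = 1, …, m}`. -/
structure IsKKTPair {n m : ℕ} (f : EuclideanSpace ℝ (Fin n) → ℝ)
    (c : Fin m → EuclideanSpace ℝ (Fin n) → ℝ) (y xs : EuclideanSpace ℝ (Fin n))
    (ls : Fin m → ℝ) : Prop where
  feasible : xs ∈ feasibleSet c
  nonneg : ∀ i, 0 ≤ ls i
  stationary : gradient (lagrangian f c y ls) xs = 0
  complementary : ∀ i, ls i * c i xs = 0

/-- The second-order sufficient optimality condition at `(xs, ls)`: the Hessian of the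
Lagrangian is uniformly positive on the kernel of the active Jacobian, the active Jacobian has
full rank, and the multipliers of the active constraints are positive. -/
structure SecondOrderSufficient {n m : ℕ} (f : EuclideanSpace ℝ (Fin n) → ℝ)
    (c : Fin m → EuclideanSpace ℝ (Fin n) → ℝ) (y xs : EuclideanSpace ℝ (Fin n))
    (ls : Fin m → ℝ) : Prop where
  hessian_pos : ∃ μ : ℝ, 0 < μ ∧ ∀ u : EuclideanSpace ℝ (Fin n), activeJacobian c xs u = 0 →
    μ * inner ℝ u u ≤ fderiv ℝ (fderiv ℝ (lagrangian f c y ls)) xs u u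
  full_rank : Module.finrank ℝ (LinearMap.range (activeJacobian c xs).toLinearMap) =
    Nat.card {i : Fin m // c i xs = 0}
  strict : ∀ i, c i xs = 0 → 0 < ls i

/-- The section at `k` of the extended dual set `Λ(l, k, δ)`: near-optimal multipliers of the
active constraints, up to `δ k`, and small multipliers of the passive ones. -/
def dualSet {n m : ℕ} (c : Fin m → EuclideanSpace ℝ (Fin n) → ℝ)
    (xs : EuclideanSpace ℝ (Fin n)) (ls : Fin m → ℝ) (k δ : ℝ) : Set (Fin m → ℝ) :=
  {l | (∀ i, c i xs = 0 → δ ≤ l i ∧ |l i - ls i| ≤ δ * k) ∧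
    (∀ i, c i xs ≠ 0 → 0 ≤ l i ∧ l i ≤ δ * k)}

/-- The stopping criterion: `x` lies in the domain of the exterior distance function and
`‖∇_x 𝓛_y(x, l, k)‖ ≤ (α / k) ‖l̄ - l‖`, where `l̄` are the multipliers updated at `x`. -/
def StoppingCriterion {n m : ℕ} (f : EuclideanSpace ℝ (Fin n) → ℝ)
    (c : Fin m → EuclideanSpace ℝ (Fin n) → ℝ) (y : EuclideanSpace ℝ (Fin n))
    (α : ℝ) (l : Fin m → ℝ) (k : ℝ) (x : EuclideanSpace ℝ (Fin n)) : Prop :=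
  x ∈ edfDomain f c y k ∧
    maxNorm (gradient (edf f c y l k) x) ≤ α / k * ‖updatedMultipliers c l k x - l‖

end

end ExteriorDistance

open ExteriorDistance

/-! The gradient of the exterior distance function at `x` is the gradient of the Lagrangian at the
pair of `x` and the updated multipliers `l̄`, and `l̄ i * c i x = (l i - l̄ i) / k` holds exactly
(`updatedMultipliers_mul`). So a point satisfying the stopping criterion solves the KKT equations
(stationarity and complementarity) with residual `O(‖l̄ - l‖ / k)`.

The second-order condition makes the derivative of these equations injective at `(xs, ls)`, so near
that pair the distance to it is at most `K` times the residual (`exists_norm_sub_le_kktMap`). Since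
`‖l̄ - l‖` is at most the error plus `‖l - ls‖`, for large `k` the error term is absorbed on the
left, which leaves the bound of claim 2. Its constant comes from `K` and the comparison of norms, so
it does not depend on `α`.

To use this local bound one must know that `(x, l̄)` is near `(xs, ls)`. Convexity supplies this
globally: relaxed level sets are bounded, a strictly feasible test point bounds `l̄` and keeps `f x`
away from `f y`, and on the resulting compact set a small residual with small infeasibility forces
closeness, because the KKT pair is unique (`exists_dist_lt_of_approx_stationary`).

For existence with positive multipliers, a maximizer of the product whose logarithm is minus the
exterior distance function is an exact stationary point. Vanishing passive multipliers are handled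
by raising all multipliers slightly and using the tolerance of the criterion
(`exists_approx_stationary`).

For strong convexity, the Hessian is that of the Lagrangian at `l̄`, positive semidefinite by
convexity, plus weighted squares of constraint derivatives. Near the KKT pair, wherever the first
part vanishes some active derivative does not (`exists_pos_hessian_add_active`), and active weights
are positive. -/

namespace ExteriorDistance

open Set Filter Topology

/-! ### Convexity through first and second derivatives -/

section Convexity

variable {E : Type*} [NormedAddCommGroup E]

/-- The first-order inequality for a convex function that is differentiable at a point. -/
theorem ConvexOn.add_fderiv_le [NormedSpace ℝ E] {s : Set E} {φ : E → ℝ} {φ' : E →L[ℝ] ℝ}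
    {a b : E} (hφ : ConvexOn ℝ s φ) (ha : a ∈ s) (hb : b ∈ s) (hd : HasFDerivAt φ φ' a) :
    φ a + φ' (b - a) ≤ φ b := by
  have hg : HasDerivAt (fun t : ℝ => φ (a + t • (b - a))) (φ' (b - a)) 0 := by
    have h1 : HasDerivAt (fun t : ℝ => a + t • (b - a)) (b - a) 0 := by
      simpa using ((hasDerivAt_id (0 : ℝ)).smul_const (b - a)).const_add a
    have h2 : HasFDerivAt φ φ' (a + (0 : ℝ) • (b - a)) := by simpa using hd
    exact h2.comp_hasDerivAt (0 : ℝ) h1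
  have hc : ConvexOn ℝ (Icc (0 : ℝ) 1) (fun t : ℝ => φ (a + t • (b - a))) := by
    have := hφ.comp_affineMap (AffineMap.lineMap a b : ℝ →ᵃ[ℝ] E)
    refine (this.subset ?_ (convex_Icc 0 1)).congr ?_
    · intro t ht
      exact hφ.1.lineMap_mem ha hb ht
    · intro t _
      simp [AffineMap.lineMap_apply, add_comm]
  have := hc.le_slope_of_hasDerivAt (x := 0) (y := 1) (by simp) (by simp) one_pos hg
  simp [slope_def_field] at this
  rw [map_sub]
  linarith

/-- A stationary point of a convex function is a global minimizer. -/
theorem ConvexOn.le_of_fderiv_eq_zero [NormedSpace ℝ E] {s : Set E} {φ : E → ℝ} {a b : E}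
    (hφ : ConvexOn ℝ s φ) (ha : a ∈ s) (hb : b ∈ s) (hd : HasFDerivAt φ (0 : E →L[ℝ] ℝ) a) :
    φ a ≤ φ b := by
  simpa using hφ.add_fderiv_le ha hb hd

/-- A function whose derivative is a monotone operator is convex. -/
theorem convexOn_of_fderiv_monotone [NormedSpace ℝ E] {s : Set E} {φ : E → ℝ}
    {φ' : E → E →L[ℝ] ℝ} (hs : Convex ℝ s) (hd : ∀ x ∈ s, HasFDerivAt φ (φ' x) x)
    (hmono : ∀ a ∈ s, ∀ b ∈ s, 0 ≤ (φ' b - φ' a) (b - a)) : ConvexOn ℝ s φ := by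
  refine ⟨hs, fun a ha b hb p q hp hq hpq => ?_⟩
  have hmem : ∀ t ∈ Icc (0 : ℝ) 1, a + t • (b - a) ∈ s := fun t ht =>
    hs.add_smul_sub_mem ha hb ht
  have hder : ∀ t ∈ Icc (0 : ℝ) 1, HasDerivAt (fun t : ℝ => φ (a + t • (b - a)))
      (φ' (a + t • (b - a)) (b - a)) t := fun t ht => by
    have h1 : HasDerivAt (fun t : ℝ => a + t • (b - a)) (b - a) t := by
      simpa using ((hasDerivAt_id t).smul_const (b - a)).const_add a
    exact (hd _ (hmem t ht)).comp_hasDerivAt t h1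
  have hc : ConvexOn ℝ (Icc (0 : ℝ) 1) (fun t : ℝ => φ (a + t • (b - a))) := by
    refine MonotoneOn.convexOn_of_deriv (convex_Icc 0 1)
      (fun t ht => (hder t ht).continuousAt.continuousWithinAt)
      (fun t ht => (hder t (interior_subset ht)).differentiableAt.differentiableWithinAt) ?_
    intro t ht t' ht' htt'
    rw [(hder t (interior_subset ht)).deriv, (hder t' (interior_subset ht')).deriv]
    rcases htt'.eq_or_lt with rfl | hlt
    · exact le_rfl
    have h := hmono _ (hmem t (interior_subset ht)) _ (hmem t' (interior_subset ht'))
    have he : a + t' • (b - a) - (a + t • (b - a)) = (t' - t) • (b - a) := by module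
    rw [he, map_smul, smul_eq_mul, sub_apply] at h
    have := nonneg_of_mul_nonneg_right h (sub_pos.2 hlt)
    linarith
  have h := hc.2 (x := 0) (by simp) (y := 1) (by simp) hp hq hpq
  have he : a + q • (b - a) = p • a + q • b := by
    rw [← eq_sub_iff_add_eq] at hpq
    subst hpq
    module
  simpa [he] using h

/-- The second derivative of a convex function is positive semidefinite. -/
theorem ConvexOn.fderiv_fderiv_nonneg [NormedSpace ℝ E] {s : Set E} {φ : E → ℝ}
    {φ' : E → E →L[ℝ] ℝ} {φ'' : E →L[ℝ] E →L[ℝ] ℝ} {x : E} (hφ : ConvexOn ℝ s φ) (hs : s ∈ 𝓝 x)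
    (hd : ∀ z ∈ s, HasFDerivAt φ (φ' z) z) (hd2 : HasFDerivAt φ' φ'' x) (u : E) :
    0 ≤ φ'' u u := by
  have h1 : HasDerivAt (fun t : ℝ => x + t • u) u 0 := by
    simpa using ((hasDerivAt_id (0 : ℝ)).smul_const u).const_add x
  have h2 : HasFDerivAt φ' φ'' (x + (0 : ℝ) • u) := by simpa using hd2
  have h3 : HasDerivAt (fun t : ℝ => φ' (x + t • u) u) (φ'' u u) 0 := by
    have := h2.comp_hasDerivAt (0 : ℝ) h1
    simpa using this.clm_apply (hasDerivAt_const (0 : ℝ) u)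
  have hev : ∀ᶠ t in 𝓝[>] (0 : ℝ), 0 ≤ slope (fun t : ℝ => φ' (x + t • u) u) 0 t := by
    have hcont : Tendsto (fun t : ℝ => x + t • u) (𝓝[>] 0) (𝓝 x) := by
      have := h1.continuousAt.tendsto
      simp only [zero_smul, add_zero] at this
      exact this.mono_left nhdsWithin_le_nhds
    filter_upwards [hcont hs, self_mem_nhdsWithin] with t ht ht0
    have hxs : x ∈ s := mem_of_mem_nhds hs
    have e1 := hφ.add_fderiv_le hxs ht (hd x hxs)
    have e2 := hφ.add_fderiv_le ht hxs (hd _ ht)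
    have ht0' : (0 : ℝ) < t := ht0
    simp only [add_sub_cancel_left, sub_add_cancel_left, map_smul, map_neg, smul_eq_mul] at e1 e2
    rw [slope_def_field]
    refine div_nonneg ?_ (by linarith)
    have : 0 ≤ t * (φ' (x + t • u) u - φ' x u) := by linarith
    simpa using nonneg_of_mul_nonneg_right this ht0'
  have h4 := (hasDerivAt_iff_tendsto_slope.1 h3).mono_left
    (nhdsWithin_mono (0 : ℝ) (fun t (ht : t ∈ Ioi (0 : ℝ)) => (ne_of_gt ht : t ≠ 0)))
  exact ge_of_tendsto h4 hev

/-- A function with a positive definite second derivative at a point is strongly convex around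
it. -/
theorem exists_strongConvexOn_ball [InnerProductSpace ℝ E] [FiniteDimensional ℝ E] {φ : E → ℝ}
    {x : E} (hφ : ContDiffAt ℝ 2 φ x) (hpos : ∀ u, u ≠ 0 → 0 < fderiv ℝ (fderiv ℝ φ) x u u) :
    ∃ ρ > 0, ∀ᶠ ε in 𝓝[>] (0 : ℝ), StrongConvexOn (Metric.ball x ε) ρ φ := by
  -- The factor 2 leaves room: one `ρ` will be spent on the error of strict differentiability, the
  -- other is the modulus of strong convexity.
  obtain ⟨ρ, hρ, hρ'⟩ : ∃ ρ > 0, ∀ u : E, 2 * ρ * ‖u‖ ^ 2 ≤ fderiv ℝ (fderiv ℝ φ) x u u := by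
    rcases subsingleton_or_nontrivial E with hE | hE
    · exact ⟨1, one_pos, fun u => by simp [Subsingleton.elim u 0]⟩
    obtain ⟨v, hv, hvmin⟩ := (isCompact_sphere (0 : E) 1).exists_isMinOn
      (NormedSpace.sphere_nonempty.2 zero_le_one)
      (f := fun u => fderiv ℝ (fderiv ℝ φ) x u u) (by fun_prop)
    have hv0 : v ≠ 0 := by rintro rfl; simp at hv
    refine ⟨fderiv ℝ (fderiv ℝ φ) x v v / 2, half_pos (hpos v hv0), fun u => ?_⟩
    rcases eq_or_ne u 0 with rfl | hu
    · simp
    have hmem : ‖u‖⁻¹ • u ∈ Metric.sphere (0 : E) 1 := by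
      simp [norm_smul, hu]
    have h := hvmin hmem
    have hn : 0 < ‖u‖ := norm_pos_iff.2 hu
    simp only [mem_ofPred_eq, map_smul, smul_apply, smul_eq_mul] at h
    rw [← mul_assoc, ← mul_inv, inv_mul_eq_div, le_div_iff₀ (by positivity)] at h
    nlinarith
  refine ⟨ρ, hρ, ?_⟩
  have hst : HasStrictFDerivAt (fderiv ℝ φ) (fderiv ℝ (fderiv ℝ φ) x) x :=
    (hφ.fderiv_right (m := 1) (by norm_num)).hasStrictFDerivAt (by norm_num)
  have hbd := hst.isLittleO.def hρ
  have hdiff : ∀ᶠ z in 𝓝 x, DifferentiableAt ℝ φ z :=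
    (hφ.eventually (by simp)).mono fun z hz => hz.differentiableAt (by norm_num)
  obtain ⟨r, hr, hball⟩ := Metric.eventually_nhds_iff_ball.1 hdiff
  obtain ⟨r', hr', hball'⟩ := Metric.eventually_nhds_iff_ball.1 hbd
  filter_upwards [Ioo_mem_nhdsGT (lt_min hr hr')] with ε hε
  rw [strongConvexOn_iff_convex]
  have hlt := lt_min_iff.1 hε.2
  -- Strong convexity is convexity of `φ - ρ/2 ‖·‖²`. Strict differentiability of the derivative of
  -- `φ` at `x` compares any two nearby points, which is what monotonicity needs.
  refine convexOn_of_fderiv_monotone (convex_ball x ε)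
    (φ' := fun z => fderiv ℝ φ z - (ρ / 2) • (2 • innerSL ℝ z)) ?_ ?_
  · intro z hz
    have h1 := (hball z (Metric.ball_subset_ball hlt.1.le hz)).hasFDerivAt
    exact h1.sub ((hasStrictFDerivAt_norm_sq z).hasFDerivAt.const_mul (ρ / 2))
  · intro a ha b hb
    have h := hball' (b, a) (by
      rw [← ball_prod_same]
      exact ⟨Metric.ball_subset_ball hlt.2.le hb, Metric.ball_subset_ball hlt.2.le ha⟩)
    have h1 := (ContinuousLinearMap.le_opNorm _ (b - a)).trans
      (mul_le_mul_of_nonneg_right h (norm_nonneg (b - a)))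
    have h2 := (abs_le.1 h1).1
    have h3 := hρ' (b - a)
    have h4 : inner ℝ b (b - a) - inner ℝ a (b - a) = ‖b - a‖ ^ 2 := by
      rw [← inner_sub_left, real_inner_self_eq_norm_sq]
    simp only [sub_apply, smul_apply,
      innerSL_apply_apply, smul_eq_mul, nsmul_eq_mul,
      Nat.cast_ofNat] at h2 ⊢
    nlinarith

end Convexity

/-! ### Compactness and local error bounds -/

/-- A continuous nonnegative function on a compact set with at most one zero is bounded away from
zero outside every ball around that zero. -/
theorem IsCompact.exists_forall_lt_imp_dist_lt {X : Type*} [PseudoMetricSpace X] {K : Set X}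
    (hK : IsCompact K) {h : X → ℝ} (hcont : ContinuousOn h K) {z₀ : X}
    (hpos : ∀ z ∈ K, h z ≤ 0 → z = z₀) {ε : ℝ} (hε : 0 < ε) :
    ∃ η > 0, ∀ z ∈ K, h z < η → dist z z₀ < ε := by
  rcases (K \ Metric.ball z₀ ε).eq_empty_or_nonempty with he | hne
  · exact ⟨1, one_pos, fun z hz _ => by
      by_contra hcon
      have : z ∈ K \ Metric.ball z₀ ε := ⟨hz, hcon⟩
      simp [he] at this⟩
  obtain ⟨w, hw, hwmin⟩ := (hK.diff Metric.isOpen_ball).exists_isMinOn hne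
    (hcont.mono sdiff_subset)
  refine ⟨h w, ?_, fun z hz hlt => ?_⟩
  · by_contra hcon
    have := hpos w hw.1 (not_lt.1 hcon)
    exact hw.2 (by simpa [this] using hε)
  · by_contra hcon
    exact absurd (hwmin (⟨hz, hcon⟩ : z ∈ K \ Metric.ball z₀ ε)) (not_le.2 hlt)

/-- Near a zero at which the derivative is injective, the distance to the zero is bounded by a
multiple of the size of the value. -/
theorem HasFDerivAt.exists_dist_le_norm {X Y : Type*} [NormedAddCommGroup X] [NormedSpace ℝ X]
    [FiniteDimensional ℝ X] [NormedAddCommGroup Y] [NormedSpace ℝ Y] {Φ : X → Y} {Φ' : X →L[ℝ] Y}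
    {z₀ : X} (hd : HasFDerivAt Φ Φ' z₀) (h0 : Φ z₀ = 0) (hinj : ∀ v, Φ' v = 0 → v = 0) :
    ∃ K > 0, ∃ ε > 0, ∀ z, dist z z₀ < ε → ‖z - z₀‖ ≤ K * ‖Φ z‖ := by
  obtain ⟨K, hK, hanti⟩ := LinearMap.exists_antilipschitzWith Φ'.toLinearMap
    (LinearMap.ker_eq_bot'.2 hinj)
  have hK' : (0 : ℝ) < K := hK
  -- With relative error `1 / (2K)`, the remainder costs half of `‖z - z₀‖` after multiplication by
  -- `K`; absorbing it doubles the constant.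
  obtain ⟨ε, hε, hball⟩ := Metric.eventually_nhds_iff_ball.1
    (hd.isLittleO.def (c := (2 * K : ℝ)⁻¹) (by positivity))
  refine ⟨2 * K, by positivity, ε, hε, fun z hz => ?_⟩
  have h1 := hball z hz
  rw [h0, sub_zero] at h1
  have h2 : ‖z - z₀‖ ≤ K * ‖Φ' (z - z₀)‖ := by
    have := hanti.le_mul_dist (z - z₀) 0
    simpa using this
  have h3 : ‖Φ' (z - z₀)‖ ≤ ‖Φ z‖ + ‖Φ z - Φ' (z - z₀)‖ := by
    have := norm_sub_le (Φ z) (Φ z - Φ' (z - z₀))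
    simpa using this
  have h4 : K * ((2 * K : ℝ)⁻¹ * ‖z - z₀‖) = ‖z - z₀‖ / 2 := by field_simp
  have h5 : K * ‖Φ' (z - z₀)‖ ≤ K * (‖Φ z‖ + (2 * K : ℝ)⁻¹ * ‖z - z₀‖) := by gcongr; linarith
  rw [mul_add, h4] at h5
  linarith

/-! ### The KKT map and derivatives of the Lagrangian and of the exterior distance function -/

noncomputable section

variable {n m : ℕ} {f : EuclideanSpace ℝ (Fin n) → ℝ} {c : Fin m → EuclideanSpace ℝ (Fin n) → ℝ}
  {x y xs : EuclideanSpace ℝ (Fin n)} {l ls : Fin m → ℝ} {k β : ℝ}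

/-- The derivative in `x` of the classical Lagrangian, as a function of the pair `(x, l)`. -/
def lagrangianFDeriv (f : EuclideanSpace ℝ (Fin n) → ℝ)
    (c : Fin m → EuclideanSpace ℝ (Fin n) → ℝ) (y : EuclideanSpace ℝ (Fin n))
    (z : EuclideanSpace ℝ (Fin n) × (Fin m → ℝ)) : EuclideanSpace ℝ (Fin n) →L[ℝ] ℝ :=
  fderiv ℝ (logObjective f y) z.1 - ∑ i, z.2 i • fderiv ℝ (c i) z.1

/-- The equations of the Karush-Kuhn-Tucker conditions: stationarity and complementarity. -/
def kktMap (f : EuclideanSpace ℝ (Fin n) → ℝ)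
    (c : Fin m → EuclideanSpace ℝ (Fin n) → ℝ) (y : EuclideanSpace ℝ (Fin n))
    (z : EuclideanSpace ℝ (Fin n) × (Fin m → ℝ)) :
    (EuclideanSpace ℝ (Fin n) →L[ℝ] ℝ) × (Fin m → ℝ) :=
  (lagrangianFDeriv f c y z, fun i => z.2 i * c i z.1)

theorem contDiffAt_logObjective (hf : ContDiff ℝ 2 f) (hx : f x < f y) :
    ContDiffAt ℝ 2 (logObjective f y) x :=
  ((contDiffAt_const.sub hf.contDiffAt).log (sub_pos.2 hx).ne').neg

theorem contDiffAt_edf (hf : ContDiff ℝ 2 f) (hc : ∀ i, ContDiff ℝ 2 (c i))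
    (hx : x ∈ edfDomain f c y k) : ContDiffAt ℝ 2 (edf f c y l k) x :=
  (contDiffAt_logObjective hf hx.1).sub (contDiffAt_const.mul
    (ContDiffAt.sum fun i _ => contDiffAt_const.mul
      (((contDiffAt_const.mul (hc i).contDiffAt).add contDiffAt_const).log (hx.2 i).ne')))

theorem isOpen_edfDomain (hf : Continuous f) (hc : ∀ i, Continuous (c i)) :
    IsOpen (edfDomain f c y k) := by
  have : edfDomain f c y k = {x | f x < f y} ∩ ⋂ i, {x | 0 < k * c i x + 1} := by
    ext; simp [edfDomain]
  rw [this]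
  refine (isOpen_lt hf continuous_const).inter (isOpen_iInter_of_finite fun i => ?_)
  exact isOpen_lt continuous_const (((hc i).const_mul k).add continuous_const)

theorem hasFDerivAt_lagrangian (hf : ContDiff ℝ 2 f) (hc : ∀ i, ContDiff ℝ 2 (c i))
    (hx : f x < f y) :
    HasFDerivAt (lagrangian f c y l) (lagrangianFDeriv f c y (x, l)) x :=
  ((contDiffAt_logObjective hf hx).differentiableAt (by norm_num)).hasFDerivAt.sub
    (HasFDerivAt.fun_sum fun i _ =>
      ((hc i).contDiffAt.differentiableAt (by norm_num)).hasFDerivAt.const_mul (l i))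

theorem hasFDerivAt_fderiv_logObjective (hf : ContDiff ℝ 2 f) (hx : f x < f y) :
    HasFDerivAt (fderiv ℝ (logObjective f y)) (fderiv ℝ (fderiv ℝ (logObjective f y)) x) x :=
  (((contDiffAt_logObjective hf hx).fderiv_right (m := 1) (by norm_num)).differentiableAt
    (by norm_num)).hasFDerivAt

theorem hasFDerivAt_fderiv_of_contDiff {φ : EuclideanSpace ℝ (Fin n) → ℝ} (hφ : ContDiff ℝ 2 φ) :
    HasFDerivAt (fderiv ℝ φ) (fderiv ℝ (fderiv ℝ φ) x) x :=
  ((hφ.contDiffAt.fderiv_right (m := 1) (by norm_num)).differentiableAt (by norm_num)).hasFDerivAt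

theorem hasFDerivAt_lagrangianFDeriv_left (hf : ContDiff ℝ 2 f) (hc : ∀ i, ContDiff ℝ 2 (c i))
    (hx : f x < f y) :
    HasFDerivAt (fun x => lagrangianFDeriv f c y (x, l))
      (fderiv ℝ (fderiv ℝ (logObjective f y)) x - ∑ i, l i • fderiv ℝ (fderiv ℝ (c i)) x) x :=
  (hasFDerivAt_fderiv_logObjective hf hx).sub
    (HasFDerivAt.fun_sum fun i _ => (hasFDerivAt_fderiv_of_contDiff (hc i)).const_smul (l i))

theorem fderiv_fderiv_lagrangian (hf : ContDiff ℝ 2 f) (hc : ∀ i, ContDiff ℝ 2 (c i))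
    (hx : f x < f y) :
    fderiv ℝ (fderiv ℝ (lagrangian f c y l)) x =
      fderiv ℝ (fderiv ℝ (logObjective f y)) x - ∑ i, l i • fderiv ℝ (fderiv ℝ (c i)) x := by
  refine HasFDerivAt.fderiv ((hasFDerivAt_lagrangianFDeriv_left hf hc hx).congr_of_eventuallyEq ?_)
  filter_upwards [(isOpen_lt hf.continuous continuous_const).mem_nhds hx] with z hz
  exact (hasFDerivAt_lagrangian hf hc hz).fderiv

theorem hasFDerivAt_lagrangianFDeriv (hf : ContDiff ℝ 2 f) (hc : ∀ i, ContDiff ℝ 2 (c i))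
    (hx : f x < f y) :
    HasFDerivAt (lagrangianFDeriv f c y)
      ((fderiv ℝ (fderiv ℝ (lagrangian f c y l)) x).comp (ContinuousLinearMap.fst ℝ _ _) -
        ∑ i, ((ContinuousLinearMap.proj i).comp (ContinuousLinearMap.snd ℝ _ _)).smulRight
          (fderiv ℝ (c i) x)) (x, l) := by
  have h1 : HasFDerivAt (fun z : EuclideanSpace ℝ (Fin n) × (Fin m → ℝ) => z.1)
    (ContinuousLinearMap.fst ℝ _ _) (x, l) := hasFDerivAt_fst
  have h2 : ∀ i, HasFDerivAt (fun z : EuclideanSpace ℝ (Fin n) × (Fin m → ℝ) => z.2 i)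
      ((ContinuousLinearMap.proj i).comp (ContinuousLinearMap.snd ℝ _ _)) (x, l) := fun i =>
    hasFDerivAt_pi'.1 hasFDerivAt_snd i
  have h3 := ((hasFDerivAt_fderiv_logObjective (x := x) hf hx).comp (x, l) h1).sub
    (HasFDerivAt.fun_sum (u := Finset.univ) fun i _ =>
      (h2 i).smul ((hasFDerivAt_fderiv_of_contDiff (x := x) (hc i)).comp (x, l) h1))
  refine h3.congr_fderiv ?_
  rw [fderiv_fderiv_lagrangian hf hc hx]
  refine ContinuousLinearMap.ext fun v => ContinuousLinearMap.ext fun w => ?_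
  simp [Finset.sum_add_distrib]
  ring

theorem continuousOn_kktMap (hf : ContDiff ℝ 2 f) (hc : ∀ i, ContDiff ℝ 2 (c i)) :
    ContinuousOn (kktMap f c y) {z | f z.1 < f y} := by
  intro z hz
  refine ContinuousAt.continuousWithinAt (ContinuousAt.prodMk
    (hasFDerivAt_lagrangianFDeriv (l := z.2) hf hc hz).continuousAt ?_)
  have := fun i => (hc i).continuous
  fun_prop

/-- The inner derivative `k` of the logarithm cancels `k⁻¹`. This is what makes the stopping
criterion a bound on a Lagrangian gradient. -/
theorem hasFDerivAt_edf (hf : ContDiff ℝ 2 f) (hc : ∀ i, ContDiff ℝ 2 (c i)) (hk : k ≠ 0)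
    (hx : x ∈ edfDomain f c y k) :
    HasFDerivAt (edf f c y l k)
      (lagrangianFDeriv f c y (x, updatedMultipliers c l k x)) x := by
  have h := ((contDiffAt_logObjective hf hx.1).differentiableAt (by norm_num)).hasFDerivAt.sub
    ((HasFDerivAt.fun_sum (u := Finset.univ) fun i _ =>
      (((((hc i).contDiffAt.differentiableAt (x := x) (by norm_num)).hasFDerivAt.const_mul
        k).add_const (1 : ℝ)).log (hx.2 i).ne').const_mul (l i)).const_mul k⁻¹)
  refine h.congr_fderiv ?_
  ext u
  simp only [lagrangianFDeriv, updatedMultipliers, sub_apply, smul_apply, sum_apply, smul_eq_mul,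
    Finset.mul_sum]
  congr 1
  refine Finset.sum_congr rfl fun i _ => ?_
  field_simp

theorem hasFDerivAt_updatedMultipliers (hc : ∀ i, ContDiff ℝ 2 (c i))
    (hx : x ∈ edfDomain f c y k) :
    HasFDerivAt (updatedMultipliers c l k)
      (ContinuousLinearMap.pi fun i => -(k * l i * ((k * c i x + 1)⁻¹) ^ 2) • fderiv ℝ (c i) x)
      x := by
  rw [hasFDerivAt_pi]
  intro i
  have h1 := (((hc i).contDiffAt.differentiableAt (x := x) (by norm_num)).hasFDerivAt.const_mul
        k).add_const (1 : ℝ)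
  have h2 := ((hasDerivAt_inv (hx.2 i).ne').comp_hasFDerivAt x h1).const_mul (l i)
  refine h2.congr_fderiv ?_
  ext u
  simp
  ring

/-- The Hessian of the exterior distance function is the Hessian of the Lagrangian at the updated
multipliers plus a nonnegative combination of the squares of the constraint derivatives. -/
theorem fderiv_fderiv_edf_apply (hf : ContDiff ℝ 2 f) (hc : ∀ i, ContDiff ℝ 2 (c i)) (hk : k ≠ 0)
    (hx : x ∈ edfDomain f c y k) (u : EuclideanSpace ℝ (Fin n)) :
    fderiv ℝ (fderiv ℝ (edf f c y l k)) x u u =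
      fderiv ℝ (fderiv ℝ (lagrangian f c y (updatedMultipliers c l k x))) x u u +
        ∑ i, k * l i * ((k * c i x + 1)⁻¹) ^ 2 * fderiv ℝ (c i) x u ^ 2 := by
  have h1 := (hasFDerivAt_lagrangianFDeriv (l := updatedMultipliers c l k x) hf hc hx.1).comp x
    ((hasFDerivAt_id x).prodMk (hasFDerivAt_updatedMultipliers (l := l) hc hx))
  have h2 : HasFDerivAt (fderiv ℝ (edf f c y l k)) _ x := h1.congr_of_eventuallyEq (by
    filter_upwards [(isOpen_edfDomain hf.continuous fun i => (hc i).continuous).mem_nhds hx]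
      with z hz
    exact (hasFDerivAt_edf hf hc hk hz).fderiv)
  rw [h2.fderiv]
  simp
  exact Finset.sum_congr rfl fun i _ => by ring

/-- The logarithm is increasing and concave and `f y - f x` is concave in `x`. -/
theorem convexOn_logObjective (hf : ConvexOn ℝ univ f) :
    ConvexOn ℝ {x | f x < f y} (logObjective f y) := by
  have hs : Convex ℝ {x | f x < f y} := by simpa using hf.convex_lt (f y)
  refine ⟨hs, fun a ha b hb p q hp hq hpq => ?_⟩
  have ha' : 0 < f y - f a := sub_pos.2 ha
  have hb' : 0 < f y - f b := sub_pos.2 hb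
  have h1 := strictConcaveOn_log_Ioi.concaveOn.2 (mem_Ioi.2 ha') (mem_Ioi.2 hb') hp hq hpq
  have h2 := hf.2 (mem_univ a) (mem_univ b) hp hq hpq
  have h3 : p • (f y - f a) + q • (f y - f b) ≤ f y - f (p • a + q • b) := by
    have : p • (f y - f a) + q • (f y - f b) = (p + q) * f y - (p • f a + q • f b) := by
      simp only [smul_eq_mul]; ring
    rw [this, hpq]
    linarith
  have h4 := Real.log_le_log ((convex_Ioi (0 : ℝ)) ha' hb' hp hq hpq) h3
  simp only [logObjective, smul_eq_mul] at *
  linarith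

theorem convexOn_lagrangian (hf : ConvexOn ℝ univ f) (hc : ∀ i, ConcaveOn ℝ univ (c i))
    (hl : ∀ i, 0 ≤ l i) : ConvexOn ℝ {x | f x < f y} (lagrangian f c y l) := by
  have h1 := convexOn_logObjective (y := y) hf
  have h2 : ConcaveOn ℝ {x | f x < f y} (fun x => ∑ i, l i * c i x) := by
    refine ⟨h1.1, fun a ha b hb p q hp hq hpq => ?_⟩
    simp only [smul_eq_mul, Finset.mul_sum, ← Finset.sum_add_distrib]
    refine Finset.sum_le_sum fun i _ => ?_
    have := mul_le_mul_of_nonneg_left ((hc i).2 (mem_univ a) (mem_univ b) hp hq hpq) (hl i)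
    simp only [smul_eq_mul] at this
    linarith
  exact h1.sub h2

theorem IsKKTPair.lagrangianFDeriv_eq_zero (hkkt : IsKKTPair f c y xs ls) (hf : ContDiff ℝ 2 f)
    (hc : ∀ i, ContDiff ℝ 2 (c i)) (hfy : f xs < f y) : lagrangianFDeriv f c y (xs, ls) = 0 := by
  have := hkkt.stationary
  rw [gradient, (hasFDerivAt_lagrangian hf hc hfy).fderiv] at this
  simpa using this

/-! ### Nondegeneracy and uniqueness of the KKT pair -/

/-- The second-order sufficient condition makes the linearized Karush-Kuhn-Tucker equations
uniquely solvable, so that near the pair their residual bounds the distance to it. -/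
theorem exists_norm_sub_le_kktMap (hf : ContDiff ℝ 2 f) (hc : ∀ i, ContDiff ℝ 2 (c i))
    (hfy : f xs < f y) (hkkt : IsKKTPair f c y xs ls) (hsosc : SecondOrderSufficient f c y xs ls) :
    ∃ K > 0, ∃ ε > 0, ∀ z, dist z (xs, ls) < ε → ‖z - (xs, ls)‖ ≤ K * ‖kktMap f c y z‖ := by
  have h1 := hasFDerivAt_lagrangianFDeriv (l := ls) hf hc hfy
  have h2 : ∀ i, HasFDerivAt
      (fun z : EuclideanSpace ℝ (Fin n) × (Fin m → ℝ) => z.2 i * c i z.1) _ (xs, ls) := fun i =>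
    (hasFDerivAt_pi'.1 hasFDerivAt_snd i).mul
      ((((hc i).contDiffAt.differentiableAt (x := xs) (by norm_num)).hasFDerivAt).comp (xs, ls)
        hasFDerivAt_fst)
  refine HasFDerivAt.exists_dist_le_norm (h1.prodMk (hasFDerivAt_pi.2 h2)) ?_ ?_
  · exact Prod.ext (hkkt.lagrangianFDeriv_eq_zero hf hc hfy) (funext hkkt.complementary)
  rintro ⟨u, v⟩ huv
  obtain ⟨e1, e2⟩ := Prod.ext_iff.1 huv
  replace e1 := fun w => DFunLike.congr_fun e1 w
  replace e2 := congr_fun e2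
  simp at e1 e2
  -- Strict complementarity splits the linearized complementarity equations: passive ones kill `v
  -- i`, active ones put `u` in the kernel of the active Jacobian.
  have hpas : ∀ i, c i xs ≠ 0 → v i = 0 := fun i hi => by
    have h0 : ls i = 0 := (mul_eq_zero.1 (hkkt.complementary i)).resolve_right hi
    simpa [h0, hi] using e2 i
  have hact : ∀ i, c i xs = 0 → fderiv ℝ (c i) xs u = 0 := fun i hi => by
    simpa [hi, (hsosc.strict i hi).ne'] using e2 i
  have hu : u = 0 := by
    obtain ⟨μ, hμ, hpos⟩ := hsosc.hessian_pos
    have h := hpos u (by ext i; exact hact i i.2)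
    have h0 : ∑ i, v i * fderiv ℝ (c i) xs u = 0 := Finset.sum_eq_zero fun i _ => by
      by_cases hi : c i xs = 0
      · rw [hact i hi, mul_zero]
      · rw [hpas i hi, zero_mul]
    have h3 := e1 u
    rw [h0, sub_zero] at h3
    rw [h3, real_inner_self_eq_norm_sq] at h
    have : ‖u‖ ^ 2 ≤ 0 := nonpos_of_mul_nonpos_right h hμ
    simpa using this
  have hsurj : LinearMap.range (activeJacobian c xs).toLinearMap = ⊤ := by
    classical
    refine Submodule.eq_top_of_finrank_eq ?_
    rw [hsosc.full_rank, Module.finrank_fintype_fun_eq_card, Nat.card_eq_fintype_card]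
  -- With `u = 0`, stationarity says that `v` annihilates all constraint derivatives; testing it on
  -- a `w` whose active derivatives are `v` itself gives `∑ v i ^ 2 = 0`.
  obtain ⟨w, hw⟩ := LinearMap.range_eq_top.1 hsurj (fun i => v i)
  have hsum : ∑ i, v i * v i = 0 := by
    have h3 := e1 w
    subst hu
    rw [map_zero, zero_apply, zero_sub, neg_eq_zero] at h3
    rw [← h3]
    refine Finset.sum_congr rfl fun i _ => ?_
    by_cases hi : c i xs = 0
    · have : fderiv ℝ (c i) xs w = v i := congr_fun hw ⟨i, hi⟩
      rw [this]
    · rw [hpas i hi, zero_mul, zero_mul]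
  have hv : v = 0 := by
    ext i
    simpa using (Finset.sum_eq_zero_iff_of_nonneg (fun i _ => mul_self_nonneg (v i))).1 hsum i
      (Finset.mem_univ i)
  rw [hu, hv]
  rfl

/-- A stationary point of the Lagrangian for nonnegative multipliers minimizes it. -/
theorem lagrangian_le_of_lagrangianFDeriv_eq_zero (hfc : ConvexOn ℝ univ f)
    (hcc : ∀ i, ConcaveOn ℝ univ (c i)) (hf : ContDiff ℝ 2 f) (hc : ∀ i, ContDiff ℝ 2 (c i))
    (hl : ∀ i, 0 ≤ l i) (hx : f x < f y) (h0 : lagrangianFDeriv f c y (x, l) = 0)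
    {z : EuclideanSpace ℝ (Fin n)} (hz : f z < f y) :
    lagrangian f c y l x ≤ lagrangian f c y l z :=
  (convexOn_lagrangian hfc hcc hl).le_of_fderiv_eq_zero hx hz
    (h0 ▸ hasFDerivAt_lagrangian hf hc hx)

theorem lagrangian_eq_logObjective (h : ∀ i, l i * c i x = 0) :
    lagrangian f c y l x = logObjective f y x := by
  simp [lagrangian, h]

theorem lagrangian_le_logObjective (hl : ∀ i, 0 ≤ l i) (hx : ∀ i, 0 ≤ c i x) :
    lagrangian f c y l x ≤ logObjective f y x :=
  sub_le_self _ (Finset.sum_nonneg fun i _ => mul_nonneg (hl i) (hx i))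

/-- Under the second-order sufficient condition the Karush-Kuhn-Tucker pair is unique. -/
theorem kktMap_eq_zero_unique (hfc : ConvexOn ℝ univ f)
    (hcc : ∀ i, ConcaveOn ℝ univ (c i)) (hf : ContDiff ℝ 2 f) (hc : ∀ i, ContDiff ℝ 2 (c i))
    (hfy : f xs < f y) (hkkt : IsKKTPair f c y xs ls) (hsosc : SecondOrderSufficient f c y xs ls)
    (hl : ∀ i, 0 ≤ l i) (hx : f x < f y) (hxc : ∀ i, 0 ≤ c i x)
    (h0 : kktMap f c y (x, l) = 0) : (x, l) = (xs, ls) := by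
  obtain ⟨K, hK, ε, hε, hloc⟩ := exists_norm_sub_le_kktMap hf hc hfy hkkt hsosc
  have hstat := hkkt.lagrangianFDeriv_eq_zero hf hc hfy
  obtain ⟨e1, e2⟩ := Prod.ext_iff.1 h0
  replace e2 : ∀ i, l i * c i x = 0 := congr_fun e2
  have A := fun z hz => lagrangian_le_of_lagrangianFDeriv_eq_zero hfc hcc hf hc hl hx e1 (z := z) hz
  have B := fun z hz => lagrangian_le_of_lagrangianFDeriv_eq_zero hfc hcc hf hc hkkt.nonneg hfy
    hstat (z := z) hz
  rw [lagrangian_eq_logObjective e2] at A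
  rw [lagrangian_eq_logObjective hkkt.complementary] at B
  have hF : logObjective f y x = logObjective f y xs := le_antisymm
    ((A xs hfy).trans (lagrangian_le_logObjective hl hkkt.feasible))
    ((B x hx).trans (lagrangian_le_logObjective hkkt.nonneg hxc))
  -- The whole segment between two KKT pairs consists of zeros of `kktMap`. The Lagrangian is affine
  -- in the multipliers, so along the segment it stays above the common optimal value; the feasible
  -- point `xt` does not exceed that value, which forces complementarity and minimality there.
  have key : ∀ t ∈ Icc (0 : ℝ) 1, kktMap f c y ((xs, ls) + t • ((x, l) - (xs, ls))) = 0 := by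
    intro t ht
    set xt := xs + t • (x - xs) with hxt
    set lt := ls + t • (l - ls) with hlt
    have hz : (xs, ls) + t • ((x, l) - (xs, ls)) = (xt, lt) := rfl
    rw [hz]
    have hconv := convexOn_logObjective (y := y) hfc
    have hxtm : f xt < f y := hconv.1.add_smul_sub_mem hfy hx ht
    have ht1 : 0 ≤ 1 - t := by linarith [ht.2]
    have hltn : ∀ i, 0 ≤ lt i := fun i => by
      have : lt i = (1 - t) * ls i + t * l i := by simp [hlt]; ring
      rw [this]
      have := hkkt.nonneg i
      have := hl i
      have := ht.1
      positivity
    have hxt' : xt = (1 - t) • xs + t • x := by rw [hxt]; module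
    have hxtc : ∀ i, 0 ≤ c i xt := fun i => by
      have h := (hcc i).2 (mem_univ xs) (mem_univ x) ht1 ht.1 (by ring)
      rw [← hxt'] at h
      refine le_trans ?_ h
      have := hkkt.feasible i
      have := hxc i
      have := ht.1
      simp only [smul_eq_mul]
      positivity
    have hFt : logObjective f y xt ≤ logObjective f y xs := by
      have h := hconv.2 hfy hx ht1 ht.1 (by ring)
      rw [← hxt', hF] at h
      refine h.trans (le_of_eq ?_)
      simp only [smul_eq_mul]; ring
    have hLlt : ∀ z, lagrangian f c y lt z =
        (1 - t) * lagrangian f c y ls z + t * lagrangian f c y l z := fun z => by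
      have : ∑ i, lt i * c i z = (1 - t) * ∑ i, ls i * c i z + t * ∑ i, l i * c i z := by
        simp only [Finset.mul_sum, ← Finset.sum_add_distrib]
        refine Finset.sum_congr rfl fun i _ => ?_
        simp [hlt]; ring
      simp only [lagrangian, this]; ring
    have hlow : ∀ z, f z < f y → logObjective f y xs ≤ lagrangian f c y lt z := fun z hz => by
      rw [hLlt]
      nlinarith [mul_le_mul_of_nonneg_left (A z hz) ht.1, mul_le_mul_of_nonneg_left (B z hz) ht1]
    have hval := hlow xt hxtm
    have hsum : ∑ i, lt i * c i xt = 0 := le_antisymm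
      (by simp only [lagrangian] at hval; linarith)
      (Finset.sum_nonneg fun i _ => mul_nonneg (hltn i) (hxtc i))
    have hcomp := (Finset.sum_eq_zero_iff_of_nonneg fun i _ =>
      mul_nonneg (hltn i) (hxtc i)).1 hsum
    have hmin : IsLocalMin (lagrangian f c y lt) xt := by
      filter_upwards [(isOpen_lt hf.continuous continuous_const).mem_nhds hxtm] with z hz
      rw [lagrangian_eq_logObjective fun i => hcomp i (Finset.mem_univ i)]
      exact hFt.trans (hlow z hz)
    have hd := hmin.hasFDerivAt_eq_zero (hasFDerivAt_lagrangian hf hc hxtm)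
    exact Prod.ext hd (funext fun i => hcomp i (Finset.mem_univ i))
  by_contra hne
  have hpos : 0 < ‖(x, l) - (xs, ls)‖ := norm_pos_iff.2 (sub_ne_zero.2 hne)
  -- A point of the segment other than `(xs, ls)` but within `ε` of it contradicts the local error
  -- bound, as its residual is zero.
  set t := min 1 (ε / (2 * ‖(x, l) - (xs, ls)‖)) with htdef
  have ht0 : 0 < t := lt_min one_pos (by positivity)
  have ht1 : t * ‖(x, l) - (xs, ls)‖ ≤ ε / 2 := by
    calc t * ‖(x, l) - (xs, ls)‖
        ≤ ε / (2 * ‖(x, l) - (xs, ls)‖) * ‖(x, l) - (xs, ls)‖ := by gcongr; exact min_le_right _ _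
      _ = ε / 2 := by field_simp
  have hnorm : ‖t • ((x, l) - (xs, ls))‖ = t * ‖(x, l) - (xs, ls)‖ := by
    rw [norm_smul, Real.norm_of_nonneg ht0.le]
  have h := hloc ((xs, ls) + t • ((x, l) - (xs, ls)))
    (by rw [dist_eq_norm, add_sub_cancel_left, hnorm]; linarith)
  rw [key t ⟨ht0.le, min_le_left _ _⟩, norm_zero, mul_zero, add_sub_cancel_left, hnorm] at h
  exact absurd h (not_le.2 (by positivity))

/-! ### Bounded level sets and strict feasibility -/

/-- A convex program with a bounded set of minimizers has bounded relaxed level sets. -/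
theorem exists_norm_sub_le_of_mem_levelSet (hfc : ConvexOn ℝ univ f)
    (hcc : ∀ i, ConcaveOn ℝ univ (c i)) (hf : Continuous f) (hc : ∀ i, Continuous (c i))
    (hxs : xs ∈ feasibleSet c) (hmin : IsMinOn f (feasibleSet c) xs)
    (hbdd : Bornology.IsBounded {x ∈ feasibleSet c | f x = f xs}) (hfy : f xs ≤ f y) :
    ∃ R > 0, ∀ x, f x ≤ f y → (∀ i, -1 ≤ c i x) → ‖x - xs‖ ≤ R := by
  obtain ⟨r, hr, hsub⟩ := hbdd.subset_ball_lt 0 xs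
  -- Pulling a far point `x` towards `xs` onto the sphere of radius `r` shrinks its excess in `f`
  -- and its violations by the factor `r / ‖x - xs‖`.
  have hscale : ∀ x, f x ≤ f y → (∀ i, -1 ≤ c i x) → r ≤ ‖x - xs‖ →
      ∃ z ∈ Metric.sphere xs r, f z - f xs ≤ r / ‖x - xs‖ * (f y - f xs) ∧
        ∀ i, -c i z ≤ r / ‖x - xs‖ := by
    intro x hx hxc hxr
    have hpos : 0 < ‖x - xs‖ := hr.trans_le hxr
    set s := r / ‖x - xs‖ with hs
    have hs0 : 0 ≤ s := by positivity
    have hs1 : 0 ≤ 1 - s := sub_nonneg.2 ((div_le_one hpos).2 hxr)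
    refine ⟨(1 - s) • xs + s • x, ?_, ?_, fun i => ?_⟩
    · have : (1 - s) • xs + s • x - xs = s • (x - xs) := by module
      rw [mem_sphere_iff_norm, this, norm_smul, Real.norm_of_nonneg hs0, hs,
        div_mul_cancel₀ _ hpos.ne']
    · have h := hfc.2 (mem_univ xs) (mem_univ x) hs1 hs0 (by ring)
      have := mul_le_mul_of_nonneg_left hx hs0
      simp only [smul_eq_mul] at h
      linarith
    · have h := (hcc i).2 (mem_univ xs) (mem_univ x) hs1 hs0 (by ring)
      have h1 := mul_le_mul_of_nonneg_left (hxc i) hs0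
      have h2 := mul_nonneg hs1 (hxs i)
      simp only [smul_eq_mul] at h
      linarith
  rcases (Metric.sphere xs r).eq_empty_or_nonempty with he | hne
  · refine ⟨r, hr, fun x hx hxc => ?_⟩
    by_contra! hcon
    obtain ⟨z, hz, -⟩ := hscale x hx hxc hcon.le
    simp [he] at hz
  obtain ⟨w, hw, hwmin⟩ := (isCompact_sphere xs r).exists_isMinOn hne
    (f := fun z => max 0 (f z - f xs) + ∑ i, max 0 (-c i z)) (by fun_prop)
  set η := max 0 (f w - f xs) + ∑ i, max 0 (-c i w) with hη
  have hsum0 : 0 ≤ ∑ i, max 0 (-c i w) := Finset.sum_nonneg fun i _ => le_max_left _ _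
  -- A zero on the sphere would be a minimizer, but all minimizers lie in the open ball.
  have hηpos : 0 < η := by
    by_contra! hcon
    have h1 : 0 ≤ max 0 (f w - f xs) := le_max_left _ _
    have h2 : ∑ i, max 0 (-c i w) = 0 := by linarith
    have hwΩ : w ∈ feasibleSet c := fun i => by
      have := (Finset.sum_eq_zero_iff_of_nonneg (fun i _ => le_max_left 0 (-c i w))).1 h2 i
        (Finset.mem_univ i)
      have h3 := le_max_right 0 (-c i w)
      linarith
    have h3 := le_max_right 0 (f w - f xs)
    have h4 : f xs ≤ f w := hmin hwΩ
    have hball := hsub (⟨hwΩ, by linarith⟩ : w ∈ {x ∈ feasibleSet c | f x = f xs})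
    rw [Metric.mem_ball] at hball
    rw [Metric.mem_sphere] at hw
    linarith
  refine ⟨max r (r * (f y - f xs + m) / η), lt_max_of_lt_left hr, fun x hx hxc => ?_⟩
  rcases le_total ‖x - xs‖ r with hxr | hxr
  · exact hxr.trans (le_max_left _ _)
  refine le_max_of_le_right ?_
  obtain ⟨z, hz, hz1, hz2⟩ := hscale x hx hxc hxr
  have hpos : 0 < ‖x - xs‖ := hr.trans_le hxr
  have h1 : max 0 (f z - f xs) ≤ r / ‖x - xs‖ * (f y - f xs) :=
    max_le (mul_nonneg (by positivity) (by linarith)) hz1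
  have h2 : ∑ i, max 0 (-c i z) ≤ m * (r / ‖x - xs‖) := by
    refine (Finset.sum_le_sum fun i _ => max_le (by positivity) (hz2 i)).trans (le_of_eq ?_)
    simp
  have h3 : η ≤ max 0 (f z - f xs) + ∑ i, max 0 (-c i z) := hwmin hz
  rw [le_div_iff₀ hηpos]
  have h4 : η ≤ r / ‖x - xs‖ * (f y - f xs + m) := by linarith
  calc ‖x - xs‖ * η ≤ ‖x - xs‖ * (r / ‖x - xs‖ * (f y - f xs + m)) := by gcongr
    _ = r * (f y - f xs + m) := by field_simp

/-- Under Slater's condition, a concave constraint is positive in the interior of the feasible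
set. -/
theorem pos_of_mem_interior_feasibleSet (hcc : ∀ i, ConcaveOn ℝ univ (c i))
    (hc : ∀ i, ContDiff ℝ 2 (c i)) (slater : ∃ x₀, ∀ i, 0 < c i x₀)
    (hy : y ∈ interior (feasibleSet c)) (i : Fin m) : 0 < c i y := by
  obtain ⟨x₀, hx₀⟩ := slater
  refine lt_of_le_of_ne (interior_subset hy i) fun h0 => ?_
  -- A zero value at an interior point is a local minimum, hence stationary, hence by concavity a
  -- global maximum, against Slater's condition.
  have hmin : IsLocalMin (c i) y := by
    filter_upwards [mem_interior_iff_mem_nhds.1 hy] with z hz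
    rw [← h0]
    exact hz i
  have hd := ((hc i).contDiffAt.differentiableAt (x := y) (by norm_num)).hasFDerivAt
  rw [hmin.fderiv_eq_zero] at hd
  have h := (hcc i).neg.le_of_fderiv_eq_zero (mem_univ y) (mem_univ x₀) (by simpa using hd.neg)
  have := hx₀ i
  simp only [Pi.neg_apply] at h
  linarith

/-- A point that is strictly feasible and strictly better than the center. -/
theorem exists_strictly_feasible (hfc : ConvexOn ℝ univ f)
    (hcc : ∀ i, ConcaveOn ℝ univ (c i)) (hc : ∀ i, ContDiff ℝ 2 (c i))
    (slater : ∃ x₀, ∀ i, 0 < c i x₀) (hy : y ∈ interior (feasibleSet c))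
    (hxs : xs ∈ feasibleSet c) (hfy : f xs < f y) :
    ∃ x₀, f x₀ < f y ∧ ∃ σ > 0, ∀ i, σ ≤ c i x₀ := by
  have hpos := pos_of_mem_interior_feasibleSet hcc hc slater hy
  have hh : (0 : ℝ) ≤ 1 / 2 := by norm_num
  refine ⟨(1 / 2 : ℝ) • xs + (1 / 2 : ℝ) • y, ?_, ?_⟩
  · have h := hfc.2 (mem_univ xs) (mem_univ y) hh hh (by norm_num)
    simp only [smul_eq_mul] at h
    linarith
  have h : ∀ i, 0 < c i ((1 / 2 : ℝ) • xs + (1 / 2 : ℝ) • y) := fun i => by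
    have h := (hcc i).2 (mem_univ xs) (mem_univ y) hh hh (by norm_num)
    simp only [smul_eq_mul] at h
    have := hpos i
    have := hxs i
    linarith
  rcases isEmpty_or_nonempty (Fin m) with hm | hm
  · exact ⟨1, one_pos, fun i => isEmptyElim i⟩
  · obtain ⟨i, hi⟩ := Finite.exists_min fun i => c i ((1 / 2 : ℝ) • xs + (1 / 2 : ℝ) • y)
    exact ⟨_, h i, hi⟩

/-! ### Localization and error bound for approximate stationary points -/

theorem updatedMultipliers_nonneg (hl : ∀ i, 0 ≤ l i) (hx : x ∈ edfDomain f c y k) (i : Fin m) :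
    0 ≤ updatedMultipliers c l k x i :=
  mul_nonneg (hl i) (inv_nonneg.2 (hx.2 i).le)

/-- The complementarity residual is exactly the multiplier step divided by `k`; every `1 / k` rate
in the proof starts here. -/
theorem updatedMultipliers_mul (hk : k ≠ 0) (hx : x ∈ edfDomain f c y k) (i : Fin m) :
    updatedMultipliers c l k x i * c i x = (l i - updatedMultipliers c l k x i) / k := by
  have := (hx.2 i).ne'
  simp only [updatedMultipliers]
  field_simp
  ring

theorem norm_kktMap_updatedMultipliers_le (hk : 0 < k) (hβ : 0 ≤ β) (hx : x ∈ edfDomain f c y k)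
    (hd : ‖lagrangianFDeriv f c y (x, updatedMultipliers c l k x)‖
      ≤ β / k * ‖updatedMultipliers c l k x - l‖) :
    ‖kktMap f c y (x, updatedMultipliers c l k x)‖
      ≤ (1 + β) / k * ‖updatedMultipliers c l k x - l‖ := by
  have hn := norm_nonneg (updatedMultipliers c l k x - l)
  refine max_le (hd.trans ?_) ?_
  · gcongr; linarith
  · refine (pi_norm_le_iff_of_nonneg (by positivity)).2 fun i => ?_
    simp only [kktMap]
    rw [updatedMultipliers_mul hk.ne' hx, norm_div, Real.norm_of_nonneg hk.le, norm_sub_rev]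
    have h1 := norm_le_pi_norm (updatedMultipliers c l k x - l) i
    calc _ ≤ ‖updatedMultipliers c l k x - l‖ / k := by gcongr; exact h1
      _ = 1 / k * ‖updatedMultipliers c l k x - l‖ := by ring
      _ ≤ _ := by gcongr; linarith

/-- Approximate minimizers of the exterior distance function and their updated multipliers are
bounded, and the objective stays away from its value at the center. -/
theorem exists_bounds_of_approx_stationary (hfc : ConvexOn ℝ univ f)
    (hcc : ∀ i, ConcaveOn ℝ univ (c i)) (hf : ContDiff ℝ 2 f) (hc : ∀ i, ContDiff ℝ 2 (c i))
    (slater : ∃ x₀, ∀ i, 0 < c i x₀) (hy : y ∈ interior (feasibleSet c))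
    (hmin : IsMinOn f (feasibleSet c) xs)
    (hbdd : Bornology.IsBounded {x ∈ feasibleSet c | f x = f xs}) (hfy : f xs < f y)
    (hkkt : IsKKTPair f c y xs ls) (hβ : 0 ≤ β) :
    ∃ R B η, 0 < η ∧ 0 ≤ B ∧ ∃ δ₀ > 0, ∃ k₀ > 0, ∀ k ≥ k₀, ∀ l : Fin m → ℝ, (∀ i, 0 ≤ l i) →
      ‖l - ls‖ ≤ δ₀ * k → ∀ x ∈ edfDomain f c y k,
      ‖lagrangianFDeriv f c y (x, updatedMultipliers c l k x)‖
        ≤ β / k * ‖updatedMultipliers c l k x - l‖ →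
      ‖x - xs‖ ≤ R ∧ f x ≤ f y - η ∧ ∀ i, updatedMultipliers c l k x i ≤ B := by
  have hxs := hkkt.feasible
  obtain ⟨R, hR, hRb⟩ := exists_norm_sub_le_of_mem_levelSet hfc hcc hf.continuous
    (fun i => (hc i).continuous) hxs hmin hbdd hfy.le
  obtain ⟨x₀, hx₀, σ, hσ, hσc⟩ := exists_strictly_feasible hfc hcc hc slater hy hxs hfy
  have hx₀R : ‖x₀ - xs‖ ≤ R := hRb x₀ hx₀.le fun i => by linarith [hσc i]
  set M := logObjective f y x₀ + 1 with hM
  set G := ‖fderiv ℝ (logObjective f y) xs‖ with hG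
  set Fl := logObjective f y xs - G * R with hFl
  set Ls := ∑ i, ls i with hLs
  have hLs0 : 0 ≤ Ls := Finset.sum_nonneg fun i _ => hkkt.nonneg i
  set q := 1 + 2 * β * R with hq
  have hq1 : 1 ≤ q := by have : 0 ≤ 2 * β * R := by positivity
                         linarith
  have hq0 : 0 < q := by linarith
  -- The choices of `δ₀` and `k₀` give `T * q ≤ 1`, half from `Ls / k` and half from `‖l - ls‖ / k`;
  -- that 1 is the one in `M`. The bound `k ≥ 4βR/σ` lets `σ/2 * S` absorb the part of the
  -- stationarity error proportional to `S`.
  refine ⟨R, max 0 (2 * (M - Fl) / σ), Real.exp (-M), Real.exp_pos _, le_max_left _ _,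
    1 / (2 * (m + 1) * q), by positivity, max 1 (max (2 * (Ls + 1) * q) (4 * β * R / σ)),
    by positivity, ?_⟩
  intro k hk l hl hlls x hx hd
  obtain ⟨hk1, hk2, hk3⟩ : 1 ≤ k ∧ 2 * (Ls + 1) * q ≤ k ∧ 4 * β * R / σ ≤ k := by
    simpa using hk
  have hk0 : 0 < k := by linarith
  set lb := updatedMultipliers c l k x with hlb
  have hlb0 := updatedMultipliers_nonneg hl hx
  have hxR : ‖x - xs‖ ≤ R := hRb x hx.1.le fun i => by
    have h := hx.2 i
    by_contra! hcon
    nlinarith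
  set S := ∑ i, lb i with hS
  have hS0 : 0 ≤ S := Finset.sum_nonneg fun i _ => hlb0 i
  set T := (∑ i, l i) / k with hT
  have hsl0 : 0 ≤ ∑ i, l i := Finset.sum_nonneg fun i _ => hl i
  have hT0 : 0 ≤ T := by positivity
  have hTq : T * q ≤ 1 := by
    have h1 : ∑ i, l i ≤ Ls + m * (1 / (2 * (m + 1) * q) * k) := by
      have : ∀ i, l i ≤ ls i + 1 / (2 * (m + 1) * q) * k := fun i => by
        have := (le_abs_self _).trans ((norm_le_pi_norm (l - ls) i).trans hlls)
        simp only [Pi.sub_apply] at this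
        linarith
      refine (Finset.sum_le_sum fun i _ => this i).trans (le_of_eq ?_)
      simp [Finset.sum_add_distrib, hLs]
    have h2 : T ≤ Ls / k + m * (1 / (2 * (m + 1) * q)) := by
      rw [hT, div_le_iff₀ hk0, add_mul, div_mul_cancel₀ _ hk0.ne']
      linarith
    have h3 : Ls / k * q ≤ 1 / 2 := by
      rw [div_mul_eq_mul_div, div_le_iff₀ hk0]
      nlinarith
    have h4 : (m : ℝ) * (1 / (2 * (m + 1) * q)) * q ≤ 1 / 2 := by
      have : (m : ℝ) * (1 / (2 * (m + 1) * q)) * q = m / (m + 1) / 2 := by field_simp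
      rw [this]
      have : (m : ℝ) / (m + 1) ≤ 1 := (div_le_one (by positivity)).2 (by linarith)
      linarith
    calc T * q ≤ (Ls / k + m * (1 / (2 * (m + 1) * q))) * q := by gcongr
      _ ≤ 1 := by rw [add_mul]; linarith
  have hnorm : ‖lb - l‖ ≤ S + ∑ i, l i := by
    refine (pi_norm_le_iff_of_nonneg (by positivity)).2 fun i => ?_
    have h1 := Finset.single_le_sum (fun i _ => hlb0 i) (Finset.mem_univ i)
    have h2 := Finset.single_le_sum (fun i _ => hl i) (Finset.mem_univ i)
    rw [Real.norm_eq_abs, Pi.sub_apply, abs_le]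
    constructor <;> linarith [hl i, hlb0 i]
  -- Approximate stationarity is tested in the direction of the strictly feasible `x₀`, where
  -- convexity and concavity turn derivatives into differences of values.
  have hDle : -(2 * β * R * (S / k + T)) ≤ lagrangianFDeriv f c y (x, lb) (x₀ - x) := by
    have h1 := (abs_le.1 ((lagrangianFDeriv f c y (x, lb)).le_opNorm (x₀ - x))).1
    have h2 : ‖x₀ - x‖ ≤ 2 * R := by
      have := norm_sub_le (x₀ - xs) (x - xs)
      rw [sub_sub_sub_cancel_right] at this
      linarith
    have h3 : ‖lagrangianFDeriv f c y (x, lb)‖ * ‖x₀ - x‖ ≤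
        β / k * (S + ∑ i, l i) * (2 * R) := by gcongr; exact hd.trans (by gcongr)
    have h4 : β / k * (S + ∑ i, l i) * (2 * R) = 2 * β * R * (S / k + T) := by
      rw [hT]; ring
    linarith
  have hFup := (convexOn_logObjective (y := y) hfc).add_fderiv_le hx.1 hx₀
    ((contDiffAt_logObjective hf hx.1).differentiableAt (by norm_num)).hasFDerivAt
  have hcup : ∀ i, lb i * (c i x₀ - c i x) ≤ lb i * fderiv ℝ (c i) x (x₀ - x) := fun i => by
    have h := (hcc i).neg.add_fderiv_le (mem_univ x) (mem_univ x₀)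
      (((hc i).contDiffAt.differentiableAt (x := x) (by norm_num)).hasFDerivAt.neg)
    simp only [Pi.neg_apply, neg_apply] at h
    exact mul_le_mul_of_nonneg_left (by linarith) (hlb0 i)
  have hsum : σ * S - T ≤ ∑ i, lb i * fderiv ℝ (c i) x (x₀ - x) := by
    have h1 : ∀ i, σ * lb i - l i / k ≤ lb i * fderiv ℝ (c i) x (x₀ - x) := fun i => by
      refine le_trans ?_ (hcup i)
      rw [mul_sub, updatedMultipliers_mul hk0.ne' hx, sub_div]
      have h2 := mul_le_mul_of_nonneg_left (hσc i) (hlb0 i)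
      have h3 : 0 ≤ lb i / k := div_nonneg (hlb0 i) hk0.le
      linarith
    refine le_trans (le_of_eq ?_) (Finset.sum_le_sum fun i _ => h1 i)
    rw [Finset.sum_sub_distrib, ← Finset.mul_sum, ← Finset.sum_div]
  have hDeq : lagrangianFDeriv f c y (x, lb) (x₀ - x) =
      fderiv ℝ (logObjective f y) x (x₀ - x) - ∑ i, lb i * fderiv ℝ (c i) x (x₀ - x) := by
    simp [lagrangianFDeriv]
  have hSk : 2 * β * R * (S / k) ≤ σ / 2 * S := by
    rw [div_le_iff₀ hσ] at hk3
    rw [mul_div_assoc', div_le_iff₀ hk0]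
    nlinarith
  have hmain : logObjective f y x + σ / 2 * S ≤ M := by
    have : T * q = T + 2 * β * R * T := by rw [hq]; ring
    rw [mul_add] at hDle
    linarith
  -- The tangent at `xs` bounds the objective below on the ball of radius `R`, so `hmain` also
  -- bounds the multiplier sum `S`.
  have hFlow : Fl ≤ logObjective f y x := by
    have h := (convexOn_logObjective (y := y) hfc).add_fderiv_le hfy hx.1
      ((contDiffAt_logObjective hf hfy).differentiableAt (by norm_num)).hasFDerivAt
    have h1 := (abs_le.1 ((fderiv ℝ (logObjective f y) xs).le_opNorm (x - xs))).1
    have h2 : G * ‖x - xs‖ ≤ G * R := by gcongr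
    linarith
  refine ⟨hxR, ?_, fun i => ?_⟩
  · have h1 : -M ≤ Real.log (f y - f x) := by
      have : 0 ≤ σ / 2 * S := by positivity
      simp only [logObjective] at hmain
      linarith
    have := (Real.le_log_iff_exp_le (sub_pos.2 hx.1)).1 h1
    linarith
  · refine le_max_of_le_right ?_
    have h1 := Finset.single_le_sum (fun i _ => hlb0 i) (Finset.mem_univ i)
    rw [le_div_iff₀ hσ]
    nlinarith

/-- Approximate minimizers of the exterior distance function and their updated multipliers are
close to the Karush-Kuhn-Tucker pair when `k` is large and `‖l - ls‖ / k` is small. -/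
theorem exists_dist_lt_of_approx_stationary (hfc : ConvexOn ℝ univ f)
    (hcc : ∀ i, ConcaveOn ℝ univ (c i)) (hf : ContDiff ℝ 2 f) (hc : ∀ i, ContDiff ℝ 2 (c i))
    (slater : ∃ x₀, ∀ i, 0 < c i x₀) (hy : y ∈ interior (feasibleSet c))
    (hmin : IsMinOn f (feasibleSet c) xs)
    (hbdd : Bornology.IsBounded {x ∈ feasibleSet c | f x = f xs}) (hfy : f xs < f y)
    (hkkt : IsKKTPair f c y xs ls) (hsosc : SecondOrderSufficient f c y xs ls) (hβ : 0 ≤ β)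
    {ε : ℝ} (hε : 0 < ε) :
    ∃ δ₀ > 0, ∃ k₀ > 0, ∀ k ≥ k₀, ∀ l : Fin m → ℝ, (∀ i, 0 ≤ l i) →
      ‖l - ls‖ ≤ δ₀ * k → ∀ x ∈ edfDomain f c y k,
      ‖lagrangianFDeriv f c y (x, updatedMultipliers c l k x)‖
        ≤ β / k * ‖updatedMultipliers c l k x - l‖ →
      dist (x, updatedMultipliers c l k x) (xs, ls) < ε := by
  obtain ⟨R, B, η, hη, hB, δ₁, hδ₁, k₁, hk₁, hbd⟩ := exists_bounds_of_approx_stationary hfc hcc hf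
    hc slater hy hmin hbdd hfy hkkt hβ
  set K : Set (EuclideanSpace ℝ (Fin n) × (Fin m → ℝ)) :=
    (Metric.closedBall xs R ×ˢ Icc 0 (fun _ => B)) ∩ {z | f z.1 ≤ f y - η} with hKdef
  have hK : IsCompact K := ((isCompact_closedBall xs R).prod isCompact_Icc).inter_right
    (isClosed_le (hf.continuous.comp continuous_fst) continuous_const)
  have hKsub : K ⊆ {z | f z.1 < f y} := fun z hz => by
    have : f z.1 ≤ f y - η := hz.2
    show f z.1 < f y
    linarith
  have hcont : ContinuousOn (fun z => ‖kktMap f c y z‖ + ∑ i, max 0 (-c i z.1)) K := by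
    refine (((continuousOn_kktMap hf hc).mono hKsub).norm).add (Continuous.continuousOn ?_)
    have := fun i => (hc i).continuous
    fun_prop
  obtain ⟨η', hη', hclose⟩ := hK.exists_forall_lt_imp_dist_lt hcont (z₀ := (xs, ls)) (by
    rintro ⟨x, l⟩ hz hle
    have h1 : 0 ≤ ∑ i, max 0 (-c i x) := Finset.sum_nonneg fun i _ => le_max_left _ _
    have h2 := norm_nonneg (kktMap f c y (x, l))
    have h3 : kktMap f c y (x, l) = 0 := norm_le_zero_iff.1 (by linarith)
    refine kktMap_eq_zero_unique hfc hcc hf hc hfy hkkt hsosc hz.1.2.1 (hKsub hz) (fun i => ?_) h3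
    have h4 := (Finset.sum_eq_zero_iff_of_nonneg (fun i _ => le_max_left 0 (-c i x))).1
      (by linarith : ∑ i, max 0 (-c i x) = 0) i (Finset.mem_univ i)
    have h5 := le_max_right 0 (-c i x)
    linarith) hε
  -- `A / k` collects the part of the residual that decays with `k`; the summand `m` accounts for
  -- infeasibility, since `-c i x ≤ 1 / k` on the domain.
  set A := (1 + β) * (B + ‖ls‖) + m with hA
  have hA0 : 0 ≤ A := by positivity
  refine ⟨min δ₁ (η' / (4 * (1 + β))), by positivity, max k₁ (4 * A / η'), by positivity, ?_⟩
  intro k hk l hl hlls x hx hd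
  obtain ⟨hk1, hk2⟩ := max_le_iff.1 hk
  have hk0 : 0 < k := hk₁.trans_le hk1
  have hlls1 : ‖l - ls‖ ≤ δ₁ * k := hlls.trans (by gcongr; exact min_le_left _ _)
  have hlls2 : ‖l - ls‖ ≤ η' / (4 * (1 + β)) * k := hlls.trans (by gcongr; exact min_le_right _ _)
  obtain ⟨h1, h2, h3⟩ := hbd k hk1 l hl hlls1 x hx hd
  have hlb0 := updatedMultipliers_nonneg hl hx
  refine hclose _ ⟨⟨by simpa [dist_eq_norm] using h1, hlb0, h3⟩, h2⟩ ?_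
  have h4 := norm_kktMap_updatedMultipliers_le hk0 hβ hx hd
  have h5 : ‖updatedMultipliers c l k x - l‖ ≤ B + ‖ls‖ + η' / (4 * (1 + β)) * k := by
    have e1 : ‖updatedMultipliers c l k x‖ ≤ B := (pi_norm_le_iff_of_nonneg hB).2 fun i => by
      rw [Real.norm_of_nonneg (hlb0 i)]; exact h3 i
    have e2 : updatedMultipliers c l k x - l = updatedMultipliers c l k x - ls - (l - ls) := by abel
    rw [e2]
    have e3 := norm_sub_le (updatedMultipliers c l k x - ls) (l - ls)
    have e4 := norm_sub_le (updatedMultipliers c l k x) ls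
    linarith
  have h6 : ∑ i, max 0 (-c i x) ≤ m * (1 / k) := by
    have : ∀ i, max 0 (-c i x) ≤ 1 / k := fun i => by
      refine max_le (by positivity) ?_
      rw [le_div_iff₀ hk0]
      linarith [hx.2 i]
    refine (Finset.sum_le_sum fun i _ => this i).trans (le_of_eq ?_)
    simp
  have h7 : (1 + β) / k * ‖updatedMultipliers c l k x - l‖ ≤
      (1 + β) / k * (B + ‖ls‖ + η' / (4 * (1 + β)) * k) := by gcongr
  have h8 : (1 + β) / k * (B + ‖ls‖ + η' / (4 * (1 + β)) * k) + m * (1 / k) = A / k + η' / 4 := by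
    rw [hA]; field_simp
    ring
  have h9 : A / k ≤ η' / 4 := by
    rw [div_le_iff₀ hη'] at hk2
    rw [div_le_iff₀ hk0]
    linarith
  show ‖kktMap f c y (x, updatedMultipliers c l k x)‖ + ∑ i, max 0 (-c i x) < η'
  linarith

/-- The error of an approximate minimizer and of its updated multipliers is at most a multiple of
`‖l - ls‖ / k`. -/
theorem exists_norm_sub_le_of_approx_stationary (hfc : ConvexOn ℝ univ f)
    (hcc : ∀ i, ConcaveOn ℝ univ (c i)) (hf : ContDiff ℝ 2 f) (hc : ∀ i, ContDiff ℝ 2 (c i))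
    (slater : ∃ x₀, ∀ i, 0 < c i x₀) (hy : y ∈ interior (feasibleSet c))
    (hmin : IsMinOn f (feasibleSet c) xs)
    (hbdd : Bornology.IsBounded {x ∈ feasibleSet c | f x = f xs}) (hfy : f xs < f y)
    (hkkt : IsKKTPair f c y xs ls) (hsosc : SecondOrderSufficient f c y xs ls) :
    ∃ C > 0, ∀ β ≥ 0, ∃ δ₀ > 0, ∃ k₀ > 0, ∀ k ≥ k₀, ∀ l : Fin m → ℝ, (∀ i, 0 ≤ l i) →
      ‖l - ls‖ ≤ δ₀ * k → ∀ x ∈ edfDomain f c y k,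
      ‖lagrangianFDeriv f c y (x, updatedMultipliers c l k x)‖
        ≤ β / k * ‖updatedMultipliers c l k x - l‖ →
      ‖(x, updatedMultipliers c l k x) - (xs, ls)‖ ≤ C / k * (1 + β) * ‖l - ls‖ := by
  obtain ⟨K, hK, ε, hε, hloc⟩ := exists_norm_sub_le_kktMap hf hc hfy hkkt hsosc
  refine ⟨2 * K, by positivity, fun β hβ => ?_⟩
  obtain ⟨δ₁, hδ₁, k₁, hk₁, hclose⟩ := exists_dist_lt_of_approx_stationary hfc hcc hf hc slater hy
    hmin hbdd hfy hkkt hsosc hβ hε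
  refine ⟨δ₁, hδ₁, max k₁ (2 * K * (1 + β)), by positivity, fun k hk l hl hlls x hx hd => ?_⟩
  obtain ⟨hk1, hk2⟩ := max_le_iff.1 hk
  have hk0 : 0 < k := hk₁.trans_le hk1
  have h1 := hloc _ (hclose k hk1 l hl hlls x hx hd)
  have h2 := norm_kktMap_updatedMultipliers_le hk0 hβ hx hd
  set e := ‖(x, updatedMultipliers c l k x) - (xs, ls)‖ with he
  have h3 : ‖updatedMultipliers c l k x - l‖ ≤ e + ‖l - ls‖ := by
    have e2 : updatedMultipliers c l k x - l = updatedMultipliers c l k x - ls - (l - ls) := by abel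
    rw [e2]
    have e3 := norm_sub_le (updatedMultipliers c l k x - ls) (l - ls)
    have e4 : ‖updatedMultipliers c l k x - ls‖ ≤ e := le_max_right _ _
    linarith
  have h4 : e ≤ K * ((1 + β) / k * (e + ‖l - ls‖)) := h1.trans (by gcongr; exact h2.trans (by gcongr))
  have h5 : K * ((1 + β) / k * (e + ‖l - ls‖)) = K * (1 + β) / k * e + K * (1 + β) / k * ‖l - ls‖ := by
    ring
  -- Here `k ≥ 2K(1 + β)` absorbs half of the error `e`; doubling gives the constant `2 * K`,
  -- independent of `β`.
  have h6 : K * (1 + β) / k * e ≤ 1 / 2 * e := by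
    refine mul_le_mul_of_nonneg_right ?_ (norm_nonneg _)
    rw [div_le_iff₀ hk0]
    linarith
  have h7 : 2 * K / k * (1 + β) * ‖l - ls‖ = 2 * (K * (1 + β) / k * ‖l - ls‖) := by ring
  linarith

/-! ### Existence of exact and approximate stationary points -/

/-- For positive multipliers the exterior distance function has a stationary point. -/
theorem exists_stationary_of_pos (hfc : ConvexOn ℝ univ f)
    (hcc : ∀ i, ConcaveOn ℝ univ (c i)) (hf : ContDiff ℝ 2 f) (hc : ∀ i, ContDiff ℝ 2 (c i))
    (hxs : xs ∈ feasibleSet c) (hmin : IsMinOn f (feasibleSet c) xs)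
    (hbdd : Bornology.IsBounded {x ∈ feasibleSet c | f x = f xs}) (hfy : f xs < f y)
    (hl : ∀ i, 0 < l i) (hk : 1 ≤ k) :
    ∃ x ∈ edfDomain f c y k, lagrangianFDeriv f c y (x, updatedMultipliers c l k x) = 0 := by
  have hk0 : 0 < k := by linarith
  have hcf := hf.continuous
  have hcont := fun i => (hc i).continuous
  obtain ⟨R, hR, hRb⟩ := exists_norm_sub_le_of_mem_levelSet hfc hcc hcf hcont hxs hmin hbdd hfy.le
  set K := {x | f x ≤ f y} ∩ ⋂ i, {x | 0 ≤ k * c i x + 1} with hKdef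
  have hmem : ∀ {x}, x ∈ K ↔ f x ≤ f y ∧ ∀ i, 0 ≤ k * c i x + 1 := by simp [hKdef]
  have hK : IsCompact K := by
    refine Metric.isCompact_of_isClosed_isBounded ?_ ?_
    · refine (isClosed_le hcf continuous_const).inter (isClosed_iInter fun i => ?_)
      exact isClosed_le continuous_const (((hcont i).const_mul k).add continuous_const)
    · refine (Metric.isBounded_closedBall (x := xs) (r := R)).subset fun z hz => ?_
      rw [Metric.mem_closedBall, dist_eq_norm]
      refine hRb z (hmem.1 hz).1 fun i => ?_
      have h := (hmem.1 hz).2 i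
      by_contra! hcon
      nlinarith
  -- `P` is the exponential of minus the exterior distance function. It extends continuously to the
  -- compact closed region `K`, and since the exponents are positive it vanishes wherever one of its
  -- bases does, so a maximizer lies in the open domain.
  set P : EuclideanSpace ℝ (Fin n) → ℝ :=
    fun x => (f y - f x) * ∏ i, (k * c i x + 1) ^ (l i / k) with hP
  have hlk : ∀ i, 0 < l i / k := fun i => div_pos (hl i) hk0
  have hPc : Continuous P := by
    refine (continuous_const.sub hcf).mul (continuous_finsetProd _ fun i _ => ?_)
    exact (((hcont i).const_mul k).add continuous_const).rpow_const fun _ => Or.inr (hlk i).le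
  have hxsc : ∀ i, 0 < k * c i xs + 1 := fun i => by
    have := mul_nonneg hk0.le (hxs i)
    linarith
  have hxsK : xs ∈ K := hmem.2 ⟨hfy.le, fun i => (hxsc i).le⟩
  obtain ⟨w, hw, hwmax⟩ := hK.exists_isMaxOn ⟨xs, hxsK⟩ hPc.continuousOn
  have hPw : 0 < P w := lt_of_lt_of_le
    (mul_pos (sub_pos.2 hfy) (Finset.prod_pos fun i _ => Real.rpow_pos_of_pos (hxsc i) _))
    (hwmax hxsK)
  have hwD : w ∈ edfDomain f c y k := by
    refine ⟨lt_of_le_of_ne (hmem.1 hw).1 fun h => ?_, fun i =>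
      lt_of_le_of_ne ((hmem.1 hw).2 i) fun h => ?_⟩
    · simp [hP, h] at hPw
    · have : ∏ i, (k * c i w + 1) ^ (l i / k) = 0 :=
        Finset.prod_eq_zero (Finset.mem_univ i) (by rw [← h, Real.zero_rpow (hlk i).ne'])
      simp [hP, this] at hPw
  have hlog : ∀ z ∈ edfDomain f c y k, Real.log (P z) = -edf f c y l k z := fun z hz => by
    have hne : ∀ i, (k * c i z + 1) ^ (l i / k) ≠ 0 := fun i =>
      (Real.rpow_pos_of_pos (hz.2 i) _).ne'
    rw [hP, Real.log_mul (sub_pos.2 hz.1).ne' (Finset.prod_ne_zero_iff.2 fun i _ => hne i),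
      Real.log_prod fun i _ => hne i]
    simp only [edf, logObjective, Finset.mul_sum]
    rw [neg_sub, sub_neg_eq_add, add_comm]
    congr 1
    refine Finset.sum_congr rfl fun i _ => ?_
    rw [Real.log_rpow (hz.2 i)]
    ring
  refine ⟨w, hwD, IsLocalMin.hasFDerivAt_eq_zero ?_ (hasFDerivAt_edf hf hc hk0.ne' hwD)⟩
  filter_upwards [(isOpen_edfDomain hcf hcont).mem_nhds hwD] with z hz
  have hzK : z ∈ K := hmem.2 ⟨hz.1.le, fun i => (hz.2 i).le⟩
  have hPz : 0 < P z :=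
    mul_pos (sub_pos.2 hz.1) (Finset.prod_pos fun i _ => Real.rpow_pos_of_pos (hz.2 i) _)
  have h := Real.log_le_log hPz (hwmax hzK)
  rw [hlog z hz, hlog w hwD] at h
  linarith

/-- Approximate minimizers of the exterior distance function exist, to every relative accuracy,
also when the multipliers of some passive constraints vanish. -/
theorem exists_approx_stationary (hfc : ConvexOn ℝ univ f)
    (hcc : ∀ i, ConcaveOn ℝ univ (c i)) (hf : ContDiff ℝ 2 f) (hc : ∀ i, ContDiff ℝ 2 (c i))
    (slater : ∃ x₀, ∀ i, 0 < c i x₀) (hy : y ∈ interior (feasibleSet c))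
    (hmin : IsMinOn f (feasibleSet c) xs)
    (hbdd : Bornology.IsBounded {x ∈ feasibleSet c | f x = f xs}) (hfy : f xs < f y)
    (hkkt : IsKKTPair f c y xs ls) (hsosc : SecondOrderSufficient f c y xs ls) (hβ : 0 < β) :
    ∃ δ₀ > 0, ∃ k₀ > 0, ∀ k ≥ k₀, ∀ l : Fin m → ℝ, (∀ i, 0 ≤ l i) →
      (∀ i, c i xs = 0 → 0 < l i) → ‖l - ls‖ ≤ δ₀ * k → ∃ x ∈ edfDomain f c y k,
      ‖lagrangianFDeriv f c y (x, updatedMultipliers c l k x)‖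
        ≤ β / k * ‖updatedMultipliers c l k x - l‖ := by
  obtain ⟨C, hC, hest⟩ := exists_norm_sub_le_of_approx_stationary hfc hcc hf hc slater hy hmin hbdd
    hfy hkkt hsosc
  obtain ⟨δ₁, hδ₁, k₁, hk₁, hest⟩ := hest 0 le_rfl
  obtain ⟨r, hr, G, hG, hGr⟩ : ∃ r > 0, ∃ G ≥ 0, ∀ x, ‖x - xs‖ < r →
      ∀ i, (c i xs ≠ 0 → 0 ≤ c i x) ∧ ‖fderiv ℝ (c i) x‖ ≤ G := by
    set G := ∑ i, (‖fderiv ℝ (c i) xs‖ + 1) with hG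
    have hev : ∀ᶠ x in 𝓝 xs, ∀ i, (c i xs ≠ 0 → 0 ≤ c i x) ∧ ‖fderiv ℝ (c i) x‖ ≤ G := by
      refine eventually_all.2 fun i => Filter.Eventually.and ?_ ?_
      · by_cases hi : c i xs = 0
        · exact Eventually.of_forall fun x h => absurd hi h
        · have : 0 < c i xs := lt_of_le_of_ne (hkkt.feasible i) (Ne.symm hi)
          filter_upwards [(hc i).continuous.continuousAt.eventually_const_lt this] with x hx _
          exact hx.le
      · have h1 : ‖fderiv ℝ (c i) xs‖ < G := by
          have := Finset.single_le_sum (f := fun i => ‖fderiv ℝ (c i) xs‖ + 1)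
            (fun i _ => by positivity) (Finset.mem_univ i)
          linarith
        have h2 : Continuous (fderiv ℝ (c i)) := (hc i).continuous_fderiv (by norm_num)
        filter_upwards [h2.norm.continuousAt.eventually_lt_const h1] with x hx
        exact hx.le
    obtain ⟨r, hr, hball⟩ := Metric.eventually_nhds_iff_ball.1 hev
    exact ⟨r, hr, G, Finset.sum_nonneg fun i _ => by positivity, fun x hx =>
      hball x (by simpa [dist_eq_norm] using hx)⟩
  set δ₀ := min (δ₁ / 2) (r / (4 * C)) with hδ₀
  have hδ₀pos : 0 < δ₀ := by positivity
  refine ⟨δ₀, hδ₀pos, max 1 (max k₁ (4 * C)), by positivity, ?_⟩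
  intro k hk l hl hlact hlls
  obtain ⟨hk1, hkk₁, hkC⟩ : 1 ≤ k ∧ k₁ ≤ k ∧ 4 * C ≤ k := by simpa using hk
  have hk0 : 0 < k := by linarith
  -- At `l = ls` the pair itself is exact. Otherwise `‖l̄ - l‖` will be at least `d / 2 > 0`, so the
  -- criterion tolerates a small gradient.
  rcases eq_or_ne l ls with rfl | hne
  · have hD : xs ∈ edfDomain f c y k := ⟨hfy, fun i => by
      have := mul_nonneg hk0.le (hkkt.feasible i)
      linarith⟩
    have hupd : updatedMultipliers c l k xs = l := funext fun i => by
      rcases mul_eq_zero.1 (hkkt.complementary i) with h | h <;> simp [updatedMultipliers, h]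
    exact ⟨xs, hD, by rw [hupd, hkkt.lagrangianFDeriv_eq_zero hf hc hfy]; simp⟩
  set d := ‖l - ls‖ with hd
  have hdpos : 0 < d := norm_pos_iff.2 (sub_ne_zero.2 hne)
  -- `Q` bounds the factors `(k * c i x + 1)⁻¹`: the 1 serves passive constraints, nonnegative near
  -- `xs`; for active ones `l i > 0` and the bound on the updated multiplier give the quotient. It
  -- may depend on `l`.
  set Q := 1 + ∑ i, (‖ls‖ + (d + 1) / 4) / l i with hQ
  have hQi : ∀ i, 0 ≤ (‖ls‖ + (d + 1) / 4) / l i := fun i => div_nonneg (by positivity) (hl i)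
  have hQ1 : 1 ≤ Q := by
    have := Finset.sum_nonneg fun i (_ : i ∈ Finset.univ) => hQi i
    linarith
  have hQ0 : 0 < Q := by linarith
  -- The four bounds serve in turn: the constant in `Q`, keeping `l'` in the range of the error
  -- estimate, `‖l̄ - l‖ ≥ d / 2`, and a gradient at most `β / k * (d / 2)`.
  set η := min (min 1 (δ₀ * k)) (min (d / (4 * (1 + Q))) (β * d / (2 * k * (m * (Q * G) + 1))))
    with hη
  have hη0 : 0 < η := by positivity
  have hη1 : η ≤ 1 := (min_le_left _ _).trans (min_le_left _ _)
  have hη2 : η ≤ δ₀ * k := (min_le_left _ _).trans (min_le_right _ _)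
  have hη3 : η ≤ d / (4 * (1 + Q)) := (min_le_right _ _).trans (min_le_left _ _)
  have hη4 : η ≤ β * d / (2 * k * (m * (Q * G) + 1)) := (min_le_right _ _).trans (min_le_right _ _)
  set l' : Fin m → ℝ := fun i => l i + η with hl'
  have hl'0 : ∀ i, 0 < l' i := fun i => add_pos_of_nonneg_of_pos (hl i) hη0
  have hl's : ‖l' - ls‖ ≤ d + η := by
    refine (pi_norm_le_iff_of_nonneg (by positivity)).2 fun i => ?_
    have h1 := norm_le_pi_norm (l - ls) i
    have h2 : (l' - ls) i = (l - ls) i + η := by simp only [hl', Pi.sub_apply]; ring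
    rw [h2]
    refine (norm_add_le _ _).trans ?_
    rw [Real.norm_of_nonneg hη0.le]
    linarith
  have hl'δ : d + η ≤ 2 * δ₀ * k := by linarith
  obtain ⟨x, hx, hstat⟩ := exists_stationary_of_pos hfc hcc hf hc hkkt.feasible hmin hbdd hfy hl'0
    hk1
  have he := hest k hkk₁ l' (fun i => (hl'0 i).le)
    (hl's.trans (hl'δ.trans (by
      have : 2 * δ₀ ≤ δ₁ := by linarith [min_le_left (δ₁ / 2) (r / (4 * C))]
      gcongr))) x hx (by rw [hstat]; simp)
  have hCk : C / k * (1 + 0) * ‖l' - ls‖ ≤ C / k * (d + η) := by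
    rw [add_zero, mul_one]; gcongr
  have hxr : ‖x - xs‖ < r := by
    have h1 : ‖x - xs‖ ≤ C / k * (d + η) := (le_max_left _ _).trans (he.trans hCk)
    have h2 : C / k * (d + η) ≤ C / k * (2 * δ₀ * k) := by gcongr
    have h3 : C / k * (2 * δ₀ * k) = 2 * C * δ₀ := by field_simp
    have h4 : 2 * C * δ₀ ≤ 2 * C * (r / (4 * C)) := by gcongr; exact min_le_right _ _
    have h5 : 2 * C * (r / (4 * C)) = r / 2 := by field_simp; norm_num
    linarith
  have hlam : ‖updatedMultipliers c l' k x - ls‖ ≤ (d + η) / 4 := by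
    refine (le_max_right _ _).trans (he.trans (hCk.trans ?_))
    have : C / k ≤ 1 / 4 := by rw [div_le_iff₀ hk0]; linarith
    calc C / k * (d + η) ≤ 1 / 4 * (d + η) := by gcongr
      _ = _ := by ring
  set q : Fin m → ℝ := fun i => (k * c i x + 1)⁻¹ with hq
  have hq0 : ∀ i, 0 ≤ q i := fun i => inv_nonneg.2 (hx.2 i).le
  have hqQ : ∀ i, q i ≤ Q := fun i => by
    by_cases hi : c i xs = 0
    · have h1 := hlact i hi
      have h2 : l i * q i ≤ ‖ls‖ + (d + 1) / 4 := by
        have h3 := (le_abs_self _).trans ((norm_le_pi_norm _ i).trans hlam)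
        have h4 := (le_abs_self _).trans (norm_le_pi_norm ls i)
        have h5 : updatedMultipliers c l' k x i = l i * q i + η * q i := by
          simp only [updatedMultipliers, hl', hq]; ring
        have h6 := mul_nonneg hη0.le (hq0 i)
        rw [Pi.sub_apply, h5] at h3
        linarith
      have h3 := Finset.single_le_sum (fun i _ => hQi i) (Finset.mem_univ i)
      have h4 : q i ≤ (‖ls‖ + (d + 1) / 4) / l i := by rw [le_div_iff₀ h1]; linarith
      linarith
    · have h1 := mul_nonneg hk0.le ((hGr x hxr i).1 hi)
      exact (inv_le_one_of_one_le₀ (by linarith)).trans hQ1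
  have hdiff : ∀ i, updatedMultipliers c l' k x i = updatedMultipliers c l k x i + η * q i :=
    fun i => by simp only [updatedMultipliers, hl', hq]; ring
  refine ⟨x, hx, ?_⟩
  have hgrad : lagrangianFDeriv f c y (x, updatedMultipliers c l k x) =
      ∑ i, (η * q i) • fderiv ℝ (c i) x := by
    have h1 : lagrangianFDeriv f c y (x, updatedMultipliers c l k x) =
        lagrangianFDeriv f c y (x, updatedMultipliers c l' k x) +
          ∑ i, (η * q i) • fderiv ℝ (c i) x := by
      simp only [lagrangianFDeriv, hdiff, add_smul, Finset.sum_add_distrib]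
      abel
    rw [h1, hstat, zero_add]
  have hgnorm : ‖lagrangianFDeriv f c y (x, updatedMultipliers c l k x)‖ ≤ m * (η * (Q * G)) := by
    rw [hgrad]
    refine (norm_sum_le_of_le _ (f := fun i => (η * q i) • fderiv ℝ (c i) x)
      (n := fun _ => η * (Q * G)) fun i _ => ?_).trans (le_of_eq (by simp))
    rw [norm_smul, Real.norm_of_nonneg (mul_nonneg hη0.le (hq0 i)), mul_assoc]
    have := hq0 i
    gcongr
    · exact hqQ i
    · exact (hGr x hxr i).2
  -- For `k ≥ 4C` the updated multipliers have moved most of the way from `l` to `ls`.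
  have hlow : d / 2 ≤ ‖updatedMultipliers c l k x - l‖ := by
    have h1 : ‖updatedMultipliers c l' k x - updatedMultipliers c l k x‖ ≤ η * Q := by
      refine (pi_norm_le_iff_of_nonneg (by positivity)).2 fun i => ?_
      rw [Pi.sub_apply, hdiff, add_sub_cancel_left,
        Real.norm_of_nonneg (mul_nonneg hη0.le (hq0 i))]
      exact mul_le_mul_of_nonneg_left (hqQ i) hη0.le
    have h2 : d ≤ ‖updatedMultipliers c l' k x - ls‖ +
        ‖updatedMultipliers c l' k x - updatedMultipliers c l k x‖ +
        ‖updatedMultipliers c l k x - l‖ := by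
      have e : l - ls = (updatedMultipliers c l' k x - ls) -
          (updatedMultipliers c l' k x - updatedMultipliers c l k x) -
          (updatedMultipliers c l k x - l) := by abel
      rw [hd, e]
      refine (norm_sub_le _ _).trans ?_
      gcongr
      exact norm_sub_le _ _
    rw [le_div_iff₀ (by positivity)] at hη3
    linarith
  refine hgnorm.trans (le_trans ?_ (mul_le_mul_of_nonneg_left hlow (by positivity)))
  rw [le_div_iff₀ (by positivity)] at hη4
  have h1 : (m : ℝ) * (η * (Q * G)) ≤ η * (m * (Q * G) + 1) := by linarith
  refine h1.trans ?_
  rw [div_mul_div_comm, le_div_iff₀ (by positivity)]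
  linarith

/-! ### Strong convexity of the exterior distance function -/

/-- Near the Karush-Kuhn-Tucker pair, the Hessian of the Lagrangian is positive definite up to the
squares of the derivatives of the active constraints. -/
theorem exists_pos_hessian_add_active (hfc : ConvexOn ℝ univ f)
    (hcc : ∀ i, ConcaveOn ℝ univ (c i)) (hf : ContDiff ℝ 2 f) (hc : ∀ i, ContDiff ℝ 2 (c i))
    (hfy : f xs < f y) (hkkt : IsKKTPair f c y xs ls) (hsosc : SecondOrderSufficient f c y xs ls) :
    ∃ ε > 0, ∀ x l, dist (x, l) (xs, ls) < ε → f x < f y → ∀ u, u ≠ 0 →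
      fderiv ℝ (fderiv ℝ (lagrangian f c y l)) x u u ≤ 0 →
      ∃ i, c i xs = 0 ∧ fderiv ℝ (c i) x u ≠ 0 := by
  classical
  -- The explicit formula makes joint continuity in the pair and the direction visible; positivity
  -- on the compact unit sphere then persists uniformly near `(xs, ls)`.
  set H : (EuclideanSpace ℝ (Fin n) × (Fin m → ℝ)) → EuclideanSpace ℝ (Fin n) → ℝ := fun z u =>
    (fderiv ℝ (fderiv ℝ (logObjective f y)) z.1 -
      ∑ i, z.2 i • fderiv ℝ (fderiv ℝ (c i)) z.1) u u +
      ∑ i with c i xs = 0, fderiv ℝ (c i) z.1 u ^ 2 with hH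
  have hHeq : ∀ x l u, f x < f y → H (x, l) u =
      fderiv ℝ (fderiv ℝ (lagrangian f c y l)) x u u +
        ∑ i with c i xs = 0, fderiv ℝ (c i) x u ^ 2 := fun x l u hx => by
    simp only [hH, fderiv_fderiv_lagrangian hf hc hx]
  have hsph : ∀ u ∈ Metric.sphere (0 : EuclideanSpace ℝ (Fin n)) 1, 0 < H (xs, ls) u := by
    intro u hu
    have hu0 : u ≠ 0 := by rintro rfl; simp at hu
    rw [hHeq _ _ _ hfy]
    have h1 : 0 ≤ fderiv ℝ (fderiv ℝ (lagrangian f c y ls)) xs u u := by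
      rw [fderiv_fderiv_lagrangian hf hc hfy]
      exact (convexOn_lagrangian hfc hcc hkkt.nonneg).fderiv_fderiv_nonneg
        ((isOpen_lt hf.continuous continuous_const).mem_nhds hfy)
        (fun z hz => hasFDerivAt_lagrangian hf hc hz)
        (hasFDerivAt_lagrangianFDeriv_left hf hc hfy) u
    have h2 : 0 ≤ ∑ i with c i xs = 0, fderiv ℝ (c i) xs u ^ 2 :=
      Finset.sum_nonneg fun i _ => sq_nonneg _
    rcases h2.eq_or_lt with h3 | h3
    · obtain ⟨μ, hμ, hpos⟩ := hsosc.hessian_pos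
      have h4 := hpos u (by
        ext i
        have := (Finset.sum_eq_zero_iff_of_nonneg (fun i _ => sq_nonneg _)).1 h3.symm i
          (by simp [i.2])
        exact pow_eq_zero_iff (two_ne_zero) |>.1 this)
      rw [real_inner_self_eq_norm_sq] at h4
      have : 0 < ‖u‖ := norm_pos_iff.2 hu0
      have : 0 < μ * ‖u‖ ^ 2 := by positivity
      linarith
    · linarith
  have hcontH : ∀ u, ContinuousAt (fun p : (EuclideanSpace ℝ (Fin n) × (Fin m → ℝ)) ×
      EuclideanSpace ℝ (Fin n) => H p.1 p.2) ((xs, ls), u) := by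
    intro u
    have hF : ContinuousAt (fun p : (EuclideanSpace ℝ (Fin n) × (Fin m → ℝ)) ×
        EuclideanSpace ℝ (Fin n) => fderiv ℝ (fderiv ℝ (logObjective f y)) p.1.1) ((xs, ls), u) := by
      have h1 : ContinuousAt (fderiv ℝ (fderiv ℝ (logObjective f y))) xs :=
        (((contDiffAt_logObjective hf hfy).fderiv_right (m := 1) (by norm_num)).fderiv_right
          (m := 0) (by norm_num)).continuousAt
      exact ContinuousAt.comp (x := ((xs, ls), u)) (g := fderiv ℝ (fderiv ℝ (logObjective f y)))
        h1 (continuous_fst.comp continuous_fst).continuousAt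
    have h2 : ∀ i, Continuous (fderiv ℝ (c i)) := fun i => (hc i).continuous_fderiv (by norm_num)
    have h3 : ∀ i, Continuous (fderiv ℝ (fderiv ℝ (c i))) := fun i =>
      ((hc i).fderiv_right (m := 1) (by norm_num)).continuous_fderiv (by norm_num)
    refine ContinuousAt.add ?_ (Continuous.continuousAt ?_)
    · refine ContinuousAt.clm_apply (ContinuousAt.clm_apply (hF.sub (Continuous.continuousAt ?_))
        continuousAt_snd) continuousAt_snd
      fun_prop
    · fun_prop
  have hev := (isCompact_sphere (0 : EuclideanSpace ℝ (Fin n)) 1).eventually_forall_of_forall_eventually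
    (x₀ := (xs, ls)) (P := fun z u => 0 < H z u)
    (fun u hu => (hcontH u).eventually_const_lt (hsph u hu))
  obtain ⟨ε, hε, hball⟩ := Metric.eventually_nhds_iff.1 hev
  refine ⟨ε, hε, fun x l hxl hx u hu hle => ?_⟩
  by_contra! hcon
  have hmem : ‖u‖⁻¹ • u ∈ Metric.sphere (0 : EuclideanSpace ℝ (Fin n)) 1 := by
    simp [norm_smul, hu]
  have h := hball hxl _ hmem
  rw [hHeq _ _ _ hx, Finset.sum_eq_zero, add_zero] at h
  · simp only [map_smul, smul_apply, smul_eq_mul] at h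
    have h1 : 0 ≤ ‖u‖⁻¹ := by positivity
    have := mul_nonpos_of_nonneg_of_nonpos h1 (mul_nonpos_of_nonneg_of_nonpos h1 hle)
    linarith
  · intro i hi
    rw [map_smul, hcon i (Finset.mem_filter.1 hi).2]
    simp

/-- The exterior distance function is strongly convex around every point of its domain that, with
its updated multipliers, is close to the Karush-Kuhn-Tucker pair. -/
theorem exists_strongConvexOn_edf (hfc : ConvexOn ℝ univ f)
    (hcc : ∀ i, ConcaveOn ℝ univ (c i)) (hf : ContDiff ℝ 2 f) (hc : ∀ i, ContDiff ℝ 2 (c i))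
    (hfy : f xs < f y) (hkkt : IsKKTPair f c y xs ls) (hsosc : SecondOrderSufficient f c y xs ls) :
    ∃ ε₀ > 0, ∀ k > 0, ∀ l : Fin m → ℝ, (∀ i, 0 ≤ l i) → (∀ i, c i xs = 0 → 0 < l i) →
      ∀ x ∈ edfDomain f c y k, dist (x, updatedMultipliers c l k x) (xs, ls) < ε₀ →
      ∃ ε : ℝ, 0 < ε ∧ Metric.ball x ε ⊆ edfDomain f c y k ∧
        ∃ ρ : ℝ, 0 < ρ ∧ StrongConvexOn (Metric.ball x ε) ρ (edf f c y l k) := by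
  obtain ⟨ε₀, hε₀, hpos⟩ := exists_pos_hessian_add_active hfc hcc hf hc hfy hkkt hsosc
  refine ⟨ε₀, hε₀, fun k hk l hl hlact x hx hdist => ?_⟩
  have hw : ∀ i u, 0 ≤ k * l i * ((k * c i x + 1)⁻¹) ^ 2 * fderiv ℝ (c i) x u ^ 2 := fun i u => by
    have := hl i
    positivity
  obtain ⟨ρ, hρ, hev⟩ := exists_strongConvexOn_ball (contDiffAt_edf (l := l) hf hc hx) (by
    intro u hu
    rw [fderiv_fderiv_edf_apply hf hc hk.ne' hx]
    have h1 : 0 ≤ fderiv ℝ (fderiv ℝ (lagrangian f c y (updatedMultipliers c l k x))) x u u := by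
      rw [fderiv_fderiv_lagrangian hf hc hx.1]
      exact (convexOn_lagrangian hfc hcc (updatedMultipliers_nonneg hl hx)).fderiv_fderiv_nonneg
        ((isOpen_lt hf.continuous continuous_const).mem_nhds hx.1)
        (fun z hz => hasFDerivAt_lagrangian hf hc hz)
        (hasFDerivAt_lagrangianFDeriv_left hf hc hx.1) u
    have h2 := Finset.sum_nonneg fun i (_ : i ∈ Finset.univ) => hw i u
    -- If the total were nonpositive, so would be the Lagrangian part; then some active derivative
    -- is nonzero along `u`, and its weight is positive. No lower bound on `k` is required.
    by_contra! hcon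
    obtain ⟨i, hi, hne⟩ := hpos x _ hdist hx.1 u hu (by linarith)
    have h3 := Finset.single_le_sum (fun i _ => hw i u) (Finset.mem_univ i)
    have h4 : 0 < k * l i * ((k * c i x + 1)⁻¹) ^ 2 * fderiv ℝ (c i) x u ^ 2 := by
      have := hlact i hi
      have := inv_pos.2 (hx.2 i)
      positivity
    linarith)
  obtain ⟨r, hr, hball⟩ := Metric.isOpen_iff.1
    (isOpen_edfDomain hf.continuous fun i => (hc i).continuous) x hx
  obtain ⟨ε, hsc, hε⟩ := (hev.and (Ioo_mem_nhdsGT hr)).exists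
  exact ⟨ε, hε.1, (Metric.ball_subset_ball hε.2.le).trans hball, ρ, hρ, hsc⟩

/-! ### Comparison of norms and the main theorem -/

theorem maxNorm_le_norm (a : EuclideanSpace ℝ (Fin n)) : maxNorm a ≤ ‖a‖ :=
  (pi_norm_le_iff_of_nonneg (norm_nonneg a)).2 fun i => PiLp.norm_apply_le a i

theorem exists_norm_le_mul_maxNorm (n : ℕ) :
    ∃ N : ℝ, 0 < N ∧ ∀ a : EuclideanSpace ℝ (Fin n), ‖a‖ ≤ N * maxNorm a := by
  obtain ⟨N, hN, h⟩ := ((EuclideanSpace.equiv (Fin n) ℝ).symm :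
    (Fin n → ℝ) →L[ℝ] EuclideanSpace ℝ (Fin n)).bound
  exact ⟨N, hN, fun a => h (WithLp.ofLp a)⟩

/-- Passive multipliers of `ls` vanish by complementarity, so both kinds of bounds in `dualSet`
measure the distance to `ls`. -/
theorem norm_sub_le_of_mem_dualSet {δ : ℝ} (hδk : 0 ≤ δ * k) (hkkt : IsKKTPair f c y xs ls)
    (hl : l ∈ dualSet c xs ls k δ) : ‖l - ls‖ ≤ δ * k := by
  refine (pi_norm_le_iff_of_nonneg hδk).2 fun i => ?_
  by_cases hi : c i xs = 0
  · exact (hl.1 i hi).2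
  · have h0 : ls i = 0 := (mul_eq_zero.1 (hkkt.complementary i)).resolve_right hi
    rw [Pi.sub_apply, h0, sub_zero, Real.norm_of_nonneg (hl.2 i hi).1]
    exact (hl.2 i hi).2

end

end ExteriorDistance

theorem mainTheorem4 {n m : ℕ} (f : EuclideanSpace ℝ (Fin n) → ℝ)
    (c : Fin m → EuclideanSpace ℝ (Fin n) → ℝ)
    (hf_convex : ConvexOn ℝ Set.univ f) (hc_concave : ∀ i, ConcaveOn ℝ Set.univ (c i))
    (hf_smooth : ContDiff ℝ 2 f) (hc_smooth : ∀ i, ContDiff ℝ 2 (c i))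
    (slater : ∃ x₀, ∀ i, 0 < c i x₀)
    (xs : EuclideanSpace ℝ (Fin n)) (hxs : xs ∈ feasibleSet c)
    (hxs_min : IsMinOn f (feasibleSet c) xs)
    (solutions_bounded : Bornology.IsBounded {x ∈ feasibleSet c | f x = f xs})
    (y : EuclideanSpace ℝ (Fin n)) (hy : y ∈ interior (feasibleSet c)) (hfy : f xs < f y)
    (ls : Fin m → ℝ) (hkkt : IsKKTPair f c y xs ls)
    (hsosc : SecondOrderSufficient f c y xs ls) :
    ∃ C : ℝ, 0 < C ∧ ∀ α : ℝ, 0 < α →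
      ∃ δ₀ : ℝ, 0 < δ₀ ∧ ∃ k₀ : ℝ, 0 < k₀ ∧
        ∀ δ : ℝ, 0 < δ → δ ≤ δ₀ → ∀ k : ℝ, k₀ ≤ k → ∀ l ∈ dualSet c xs ls k δ,
          (∃ x, StoppingCriterion f c y α l k x) ∧
          ∀ x, StoppingCriterion f c y α l k x →
            max (maxNorm (x - xs)) ‖updatedMultipliers c l k x - ls‖
                ≤ C / k * (1 + 2 * α) * ‖l - ls‖ ∧
            ∃ ε : ℝ, 0 < ε ∧ Metric.ball x ε ⊆ edfDomain f c y k ∧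
              ∃ ρ : ℝ, 0 < ρ ∧ StrongConvexOn (Metric.ball x ε) ρ (edf f c y l k) := by
  obtain ⟨N, hN, hNorm⟩ := exists_norm_le_mul_maxNorm n
  obtain ⟨C, hC, hest⟩ := exists_norm_sub_le_of_approx_stationary hf_convex hc_concave hf_smooth
    hc_smooth slater hy hxs_min solutions_bounded hfy hkkt hsosc
  obtain ⟨ε₀, hε₀, hsc⟩ := exists_strongConvexOn_edf hf_convex hc_concave hf_smooth hc_smooth hfy
    hkkt hsosc
  -- Passing from the max-norm to the Euclidean norm turns `α` into `N * α`, and `1 + N * α ≤ (1 +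
  -- N) * (1 + 2 * α)` keeps the constant free of `α`.
  refine ⟨C * (1 + N), by positivity, fun α hα => ?_⟩
  have hNα : 0 ≤ N * α := by positivity
  obtain ⟨δ₁, hδ₁, k₁, hk₁, hest⟩ := hest (N * α) hNα
  obtain ⟨δ₂, hδ₂, k₂, hk₂, hex⟩ := exists_approx_stationary hf_convex hc_concave hf_smooth
    hc_smooth slater hy hxs_min solutions_bounded hfy hkkt hsosc hα
  -- The last bound makes the error `C * (1 + N * α) * δ` at most `ε₀ / 2`, inside the neighborhood
  -- of strong convexity.
  refine ⟨min (min δ₁ δ₂) (ε₀ / (2 * C * (1 + N * α))), by positivity, max k₁ k₂, by positivity, ?_⟩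
  intro δ hδ hδδ₀ k hk l hl
  obtain ⟨⟨hδ1, hδ2⟩, hδ3⟩ : (δ ≤ δ₁ ∧ δ ≤ δ₂) ∧ δ ≤ ε₀ / (2 * C * (1 + N * α)) := by
    simpa using hδδ₀
  obtain ⟨hk1, hk2⟩ := max_le_iff.1 hk
  have hk0 : 0 < k := hk₁.trans_le hk1
  have hlact : ∀ i, c i xs = 0 → 0 < l i := fun i hi => hδ.trans_le (hl.1 i hi).1
  have hl0 : ∀ i, 0 ≤ l i := fun i => by
    by_cases hi : c i xs = 0
    · exact (hlact i hi).le
    · exact (hl.2 i hi).1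
  have hlls := norm_sub_le_of_mem_dualSet (by positivity) hkkt hl
  have hgrad : ∀ x ∈ edfDomain f c y k, ‖gradient (edf f c y l k) x‖ =
      ‖lagrangianFDeriv f c y (x, updatedMultipliers c l k x)‖ := fun x hx => by
    rw [gradient, LinearIsometryEquiv.norm_map,
      (hasFDerivAt_edf hf_smooth hc_smooth hk0.ne' hx).fderiv]
  refine ⟨?_, fun x ⟨hx, hcrit⟩ => ?_⟩
  · obtain ⟨x, hx, hd⟩ := hex k hk2 l hl0 hlact (hlls.trans (by gcongr))
    exact ⟨x, hx, (maxNorm_le_norm _).trans ((hgrad x hx).trans_le hd)⟩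
  have hd : ‖lagrangianFDeriv f c y (x, updatedMultipliers c l k x)‖
      ≤ N * α / k * ‖updatedMultipliers c l k x - l‖ := by
    rw [← hgrad x hx]
    refine (hNorm _).trans ((mul_le_mul_of_nonneg_left hcrit hN.le).trans (le_of_eq ?_))
    ring
  have he := hest k hk1 l hl0 (hlls.trans (by gcongr)) x hx hd
  refine ⟨?_, hsc k hk0 l hl0 hlact x hx ?_⟩
  · refine le_trans (max_le_max (maxNorm_le_norm _) le_rfl) (he.trans ?_)
    have h1 : C / k * (1 + N * α) ≤ C / k * ((1 + N) * (1 + 2 * α)) := by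
      gcongr
      nlinarith
    have h2 : C * (1 + N) / k * (1 + 2 * α) = C / k * ((1 + N) * (1 + 2 * α)) := by ring
    rw [h2]
    gcongr
  · rw [dist_eq_norm]
    refine he.trans_lt ?_
    have h1 : C / k * (1 + N * α) * ‖l - ls‖ ≤ C / k * (1 + N * α) * (δ * k) := by gcongr
    have h2 : C / k * (1 + N * α) * (δ * k) = C * (1 + N * α) * δ := by field_simp
    rw [le_div_iff₀ (by positivity)] at hδ3
    linarith
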